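/- **Setting.** Let $\mathcal O=\Gamma\backslash\mathbb H$ be a two-dimensional hyperbolic orbifold, where $\Gamma$ is a discrete group of orientation-preserving isometries of the upper half plane $\mathbb H$ (a discrete subgroup of $SL_2(\mathbb R)$ acting by Möbius transformations on $\mathbb H$ and on $\partial\mathbb H=\mathbb R\cup\{\infty\}$). A *quotient triangulation* of $\mathcal O$ is given by the lift $T$ to $\mathbb H$ of its non-structural arcs (the structural arcs, those ending at a cone point of angle $2\pi/3$, are determined by the others and play no role in cutting sequences): $T$ is a $\Gamma$-invariant, locally finite tiling of $\mathbb H$ by ideal triangles with pairwise disjoint interiors, all of whose vertices are cusps of $\Gamma$ (fixed points of parabolic elements), and which has finitely many triangles up to $\Gamma$. Paths on $\mathcal O$, and their homotopies, are given by lifts to $\mathbb H$. Let $E$ be an edge of $T$, and let $\zeta:[0,\infty)\to\mathbb H$ be (a lift of) a path with $\zeta(0)\in E$ which converges, in the Riemann sphere, to a point $\alpha\in\partial\mathbb H$. **Cutting sequence.** The (reduced) cutting sequence of $\zeta$ from $E$ with respect to $T$ is the word in $L,R$ obtained by following the successive edges of $T$, starting with $E$, behind which $\zeta$ finally stays (crossings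 that are undone later cancel; for a geodesic ray these are the edges crossed). If $\zeta$ in this sense enters a triangle with vertices $A,B,C$ in clockwise order through the side $AB$, the letter is $L$ if it leaves through $BC$ and $R$ if it leaves through $AC$. If the word is infinite and of the form $L^{a_0}R^{a_1}L^{a_2}R^{a_3}\cdots$ with infinitely many blocks, $a_0\ge 0$ and $a_i\ge1$ for $i\ge1$, put $\eta((\zeta,T))=[a_0;a_1,a_2,\dots]$. **Essential periodicity.** $ESP^+$ is the set of positive infinite continued fractions (that is, with $a_0\ge 0$, and $a_i\geq 1$ for $i\ge 1$) of one of the forms $[a_0;\overline{a_1,\dots,a_s}]$ with $s\ge1$ and $a_0\le a_s$, or $[0;a_1,\overline{a_2,\dots,a_{s+1}}]$ with $s\ge 1$ and $a_1\le a_{s+1}$, the bar denoting periodic repetition. **Homotopic to a closed curve.** A closed curve on $\mathcal O$, run through infinitely often in both directions, lifts to a continuous $c:\mathbb R\to\mathbb H$ with $c(t+1)=g\,c(t)$ for all $t$ and some $g\in\Gamma$; it is *peripheral* (homotopic into a cusp) if $g$ is parabolic. It *crosses $E$ at its start* if $c(0)\in E$ and $c(t)$ lies on one open side of $E$ for all sufficiently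 large $t$ and on the other open side for all sufficiently small (negative) $t$. The path $\zeta$ is *homotopic to a closed curve, relative to $E$*, if there are a non-peripheral closed curve crossing $E$ at its start, with lift $c$ as above, and a homotopy from $\zeta$ to $c|_{[0,\infty)}$ through paths in $\mathbb H$ that start on $E$ and terminate at $\alpha$ (the homotopy extending continuously by the constant $\alpha$ to the endpoints at infinity). **Theorem 3.4.** The path $\zeta$ is homotopic to a closed curve on $\mathcal O$, relative to its starting edge $E$, if and only if its cutting sequence has infinitely many blocks and $\eta((\zeta,T))\in ESP^+$. -/

import Mathlib

open Filter Topology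
open scoped NNReal MatrixGroups UpperHalfPlane unitInterval

noncomputable section

namespace CuttingSeq

/-! ### The hyperbolic plane and its boundary -/

/-- The boundary `ℝ ∪ {∞}` of the upper half plane. -/
abbrev Bdry : Type := OnePoint ℝ

/-- The upper half plane inside the Riemann sphere. -/
def toSphere (z : ℍ) : OnePoint ℂ := ((z : ℂ) : OnePoint ℂ)

/-- The boundary circle `ℝ ∪ {∞}` inside the Riemann sphere. -/
def bdryToSphere (α : Bdry) : OnePoint ℂ := OnePoint.map (fun x : ℝ => (x : ℂ)) α

/-- The action of `SL(2, ℝ)` on the boundary by Möbius transformations. -/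
def bdryAct (g : SL(2, ℝ)) (α : Bdry) : Bdry := Matrix.SpecialLinearGroup.toGL g • α

/-- The hyperbolic geodesic with ideal endpoints `A` and `B`: a vertical half-line, or the
semicircle with diameter `[a, b]`. It is empty if `A = B`. -/
def geodesic : Bdry → Bdry → Set ℍ
  | some a, some b => {z | (z.re - a) * (z.re - b) + z.im ^ 2 = 0}
  | some a, none => {z | z.re = a}
  | none, some b => {z | z.re = b}
  | none, none => ∅

/-- The open half plane on the right-hand side of the geodesic oriented from `A` to `B`. -/
def rightOf : Bdry → Bdry → Set ℍ
  | some a, some b => {z | (b - a) * ((z.re - a) * (z.re - b) + z.im ^ 2) < 0}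
  | some a, none => {z | a < z.re}
  | none, some b => {z | z.re < b}
  | none, none => ∅

/-- `A`, `B`, `C` are distinct boundary points met in this order when the boundary is run through
clockwise, that is, with the upper half plane on the right-hand side. -/
def Clockwise : Bdry → Bdry → Bdry → Prop
  | some a, some b, some c => 0 < (b - a) * (c - b) * (a - c)
  | some a, some b, none => b < a
  | some a, none, some c => a < c
  | none, some b, some c => c < b
  | _, _, _ => False

/-! ### Ideal triangulations -/

/-- The interior of the ideal triangle with vertex set `t`: the points to the right of the three
sides, the vertices being labelled clockwise. -/
def openTriangle (t : Set Bdry) : Set ℍ :=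
  {z | ∀ A ∈ t, ∀ B ∈ t, ∀ C ∈ t, Clockwise A B C → z ∈ rightOf A B}

/-- The closed ideal triangle with vertex set `t` (without its ideal vertices). The open left-hand
side of `A → B` is the right-hand side of `B → A`. -/
def closedTriangle (t : Set Bdry) : Set ℍ :=
  {z | ∀ A ∈ t, ∀ B ∈ t, ∀ C ∈ t, Clockwise A B C → z ∉ rightOf B A}

/-- A set of ideal triangles, each given by its set of three vertices, is an ideal triangulation of
the hyperbolic plane: the closed triangles cover, distinct triangles have disjoint interiors, and
the collection is locally finite. -/
structure IsIdealTriangulation (T : Set (Set Bdry)) : Prop where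
  card : ∀ t ∈ T, t.ncard = 3
  cover : ∀ z : ℍ, ∃ t ∈ T, z ∈ closedTriangle t
  disj : ∀ s ∈ T, ∀ t ∈ T, s ≠ t → Disjoint (openTriangle s) (openTriangle t)
  locallyFinite : ∀ z : ℍ, ∃ U ∈ 𝓝 z, {t ∈ T | (closedTriangle t ∩ U).Nonempty}.Finite

/-- The orbifold is `Γ \ ℍ` for a discrete group `Γ` of orientation-preserving isometries. A
quotient triangulation of it is given by the lift `T` to the hyperbolic plane of its arcs other than
the structural ones (the structural arcs are determined by these): a `Γ`-invariant ideal
triangulation with vertices at cusps and with only finitely many triangles up to the action of `Γ`.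
An arc from a cusp to a cone point of angle `π` lifts to geodesics through fixed points of
involutions in `Γ`; a cone point of angle `2π/3` lifts to the centre of a triangle. -/
structure IsQuotientTriangulation (Γ : Subgroup SL(2, ℝ)) (T : Set (Set Bdry)) : Prop where
  discrete : DiscreteTopology Γ
  triangulation : IsIdealTriangulation T
  invariant : ∀ g ∈ Γ, ∀ t ∈ T, bdryAct g '' t ∈ T
  cusps : ∀ t ∈ T, ∀ A ∈ t, IsCusp A (Γ.map Matrix.SpecialLinearGroup.toGL)
  finiteQuotient : ∃ F : Set (Set Bdry), F.Finite ∧ ∀ t ∈ T, ∃ g ∈ Γ, bdryAct g '' t ∈ F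

/-- `A` and `B` are the endpoints of an edge of the triangulation `T`. -/
def IsEdge (T : Set (Set Bdry)) (A B : Bdry) : Prop :=
  A ≠ B ∧ ∃ t ∈ T, A ∈ t ∧ B ∈ t

/-! ### Paths and closed curves

A path on the orbifold `Γ \ ℍ` is given by a lift, a continuous path in the hyperbolic plane,
which is unique up to the action of `Γ`. Homotopies are homotopies of lifts. -/

/-- The path `ζ` terminates at the boundary point `α`. -/
def TerminatesAt (ζ : C(ℝ≥0, ℍ)) (α : Bdry) : Prop :=
  Tendsto (fun t => toSphere (ζ t)) atTop (𝓝 (bdryToSphere α))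

/-- A closed curve on the orbifold `Γ \ ℍ`, by a lift run through infinitely often in both
directions: one turn of the curve carries the lift to its translate by an element of `Γ`. -/
structure ClosedCurve (Γ : Subgroup SL(2, ℝ)) where
  lift : C(ℝ, ℍ)
  deck : SL(2, ℝ)
  deck_mem : deck ∈ Γ
  lift_add_one : ∀ t, lift (t + 1) = deck • lift t

/-- The closed curve is peripheral: it can be homotoped into a cusp. -/
def ClosedCurve.IsPeripheral {Γ : Subgroup SL(2, ℝ)} (c : ClosedCurve Γ) : Prop :=
  (Matrix.SpecialLinearGroup.toGL c.deck).IsParabolic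

/-- The closed curve starts on the edge with endpoints `A` and `B` and crosses it essentially: it
departs from the edge to one side and comes from the other side, up to excursions that do not
change on which side of the edge the two ends of the lift lie. -/
def ClosedCurve.CrossesAtStart {Γ : Subgroup SL(2, ℝ)} (c : ClosedCurve Γ) (A B : Bdry) : Prop :=
  c.lift 0 ∈ geodesic A B ∧
    (((∀ᶠ t in atTop, c.lift t ∈ rightOf A B) ∧ (∀ᶠ t in atBot, c.lift t ∈ rightOf B A)) ∨
      ((∀ᶠ t in atTop, c.lift t ∈ rightOf B A) ∧ (∀ᶠ t in atBot, c.lift t ∈ rightOf A B)))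

/-- The infinite path that starts at the base point of a closed curve and goes round it forever. -/
def ClosedCurve.ray {Γ : Subgroup SL(2, ℝ)} (c : ClosedCurve Γ) : C(ℝ≥0, ℍ) :=
  c.lift.comp ⟨fun t : ℝ≥0 => (t : ℝ), NNReal.continuous_coe⟩

/-- `ζ` and `ξ` are homotopic through paths that start on the edge with endpoints `A`, `B` and
terminate at the boundary point `α`; the homotopy extends continuously by the constant `α` to the
endpoints at infinity. -/
def HomotopicRelEdge (A B α : Bdry) (ζ ξ : C(ℝ≥0, ℍ)) : Prop :=
  ∃ H : C(I × ℝ≥0, ℍ),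
    (∀ t, H (0, t) = ζ t) ∧ (∀ t, H (1, t) = ξ t) ∧ (∀ s, H (s, 0) ∈ geodesic A B) ∧
      Tendsto (fun p => toSphere (H p)) (⊤ ×ˢ atTop) (𝓝 (bdryToSphere α))

/-- The path `ζ`, starting on the edge with endpoints `A`, `B` and terminating at `α`, is homotopic
to a (non-peripheral) closed curve of the orbifold `Γ \ ℍ` that crosses the starting edge. -/
def HomotopicToClosedCurve (Γ : Subgroup SL(2, ℝ)) (A B α : Bdry) (ζ : C(ℝ≥0, ℍ)) : Prop :=
  ∃ c : ClosedCurve Γ, ¬ c.IsPeripheral ∧ c.CrossesAtStart A B ∧ HomotopicRelEdge A B α ζ c.ray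

/-! ### Cutting sequences -/

/-- The letters of cutting sequences. -/
inductive Letter
  | L
  | R

/-- `w` is the (reduced, infinite) cutting sequence of `ζ`, from the starting edge with endpoints
`A`, `B`, with respect to `T`, as a word in `L` and `R`.

The `n`-th edge, with endpoints `P n`, `Q n`, is oriented so that `ζ` finally stays on the
right-hand side of `P n → Q n`. The path enters the triangle with clockwise vertices `P n`, `Q n`,
`V n` through this edge, and the triangle is a left triangle, contributing `L`, if the path leaves
through the side `Q n`, `V n`, and a right triangle, contributing `R`, if it leaves through `P n`,
`V n`. Crossings of an edge that are undone later cancel in the reduced word, so that the edges that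
count are those behind which the path finally stays. For a geodesic ray these are just the edges
crossed, in the order of crossing. -/
def IsCuttingWord (T : Set (Set Bdry)) (A B : Bdry) (ζ : C(ℝ≥0, ℍ)) (w : ℕ → Letter) : Prop :=
  ∃ P Q V : ℕ → Bdry,
    ((P 0 = A ∧ Q 0 = B) ∨ (P 0 = B ∧ Q 0 = A)) ∧
    (∀ n, ∀ᶠ t in atTop, ζ t ∈ rightOf (P n) (Q n)) ∧
    (∀ n, {P n, Q n, V n} ∈ T ∧ Clockwise (P n) (Q n) (V n)) ∧
    (∀ n, (w n = Letter.L ∧ P (n + 1) = V n ∧ Q (n + 1) = Q n) ∨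
      (w n = Letter.R ∧ P (n + 1) = P n ∧ Q (n + 1) = V n))

/-- `w = L ^ a₀ R ^ a₁ L ^ a₂ ⋯` with `a₀ ≥ 0` and `aᵢ ≥ 1` for `i ≥ 1`. -/
def HasExponents (w : ℕ → Letter) (a : ℕ → ℕ) : Prop :=
  (∀ i, 1 ≤ i → 0 < a i) ∧
    ∀ i k, ∑ j ∈ Finset.range i, a j ≤ k → k < ∑ j ∈ Finset.range (i + 1), a j →
      w k = if Even i then Letter.L else Letter.R

/-- The sequence of indices `a₀, a₁, a₂, …` is the cutting sequence of `ζ` with respect to `T`. -/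
def IsCuttingSequence (T : Set (Set Bdry)) (A B : Bdry) (ζ : C(ℝ≥0, ℍ)) (a : ℕ → ℕ) : Prop :=
  ∃ w, IsCuttingWord T A B ζ w ∧ HasExponents w a

/-! ### Continued fractions -/

/-- The continued fraction `[a₀; a₁, a₂, …]`, as its sequence of partial quotients, that is read off
from a cutting sequence. -/
def eta (a : ℕ → ℕ) : ℕ → ℤ := fun i => (a i : ℤ)

/-- The infinite simple continued fractions, by their sequences of partial quotients. -/
def InfContFrac : Set (ℕ → ℤ) := {a | ∀ i, 1 ≤ i → 0 < a i}

/-- The essentially periodic continued fractions: those of the form `[a₀; (a₁, …, aₛ)]` with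
`a₀ ≤ aₛ`, or `[0; a₁, (a₂, …, aₛ₊₁)]` with `a₁ ≤ aₛ₊₁`, the part in parentheses being repeated
periodically. -/
def ESP : Set (ℕ → ℤ) :=
  {a | a ∈ InfContFrac ∧
    ((∃ s, 1 ≤ s ∧ (∀ i, 1 ≤ i → a (i + s) = a i) ∧ a 0 ≤ a s) ∨
      (a 0 = 0 ∧ ∃ s, 1 ≤ s ∧ (∀ i, 2 ≤ i → a (i + s) = a i) ∧ a 1 ≤ a (s + 1)))}

/-- The positive essentially periodic continued fractions. The value of an infinite continued
fraction lies strictly between `a₀` and `a₀ + 1`, so it is positive if and only if `a₀ ≥ 0`. -/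
def ESPPlus : Set (ℕ → ℤ) := {a | a ∈ ESP ∧ 0 ≤ a 0}

end CuttingSeq

end

open CuttingSeq

namespace CuttingSeq

open scoped OnePoint

/-! ### Homogeneous coordinates on the boundary -/

/-! Both sides of the equivalence amount to one condition: `ζ` has a purely periodic cutting word
containing both letters. On the side of continued fractions, deleting one period from such a word
cuts some block of the word, and uniqueness of the exponents identifies the original exponents with
those of the shortened word. The first block is then the remainder of the cut block. This gives the
inequality in `ESP`, and the parity of the cut block decides between its two forms
(`HasExponents.eta_mem_ESPPlus`, `HasExponents.exists_period`).

From a closed curve to a word: let `g` be the deck transformation and `E` the starting edge. Edges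
do not cross and the two ends of the lift lie on different sides of `E`, so `gE` lies strictly
behind `E` (`ClosedCurve.nested_deck`). Local finiteness makes the chain of triangles from `E` to
`gE` finite, and its translates by powers of `g` form an infinite chain with a periodic word. An
element of `Γ` that fixes exactly one endpoint of an edge is parabolic, since otherwise the images
of the edge would accumulate (`isParabolic_of_fixes`). Hence `g` moves both endpoints of every edge
of the chain. Therefore both letters occur, and the half planes shrink strictly at both ends after
each period. Every path with the same terminal point finally stays behind each edge of the chain,
and `ζ` is such a path (`Nested.eventually_mem_rightOf`).

From a word to a closed curve: modulo `Γ` there are finitely many oriented edges, so some `g` in `Γ`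
carries the edge at one multiple of the period to the edge at another. A triangle is determined by
an oriented side, so `g` shifts the whole sequence of edges (`exists_shift`). As both letters occur,
`g` maps the arc behind `E` into itself and moves both endpoints. Hence `g` is hyperbolic, its axis
crosses `E`, and `ζ` must end at the attracting fixed point (`exists_closedCurve`). The axis is the
required closed curve, and a straight-line homotopy in suitable coordinates joins `ζ` to it
(`homotopicRelEdge`). -/

lemma infty_or_coe (A : Bdry) : A = ∞ ∨ ∃ a : ℝ, A = (a : Bdry) := by
  induction A using OnePoint.rec with
  | infty => exact Or.inl rfl
  | coe a => exact Or.inr ⟨a, rfl⟩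

/-- First homogeneous coordinate of a boundary point. -/
noncomputable def hx : Bdry → ℝ
  | OnePoint.some a => a
  | ∞ => 1

/-- Second homogeneous coordinate of a boundary point. -/
noncomputable def hy : Bdry → ℝ
  | OnePoint.some _ => 1
  | ∞ => 0

@[simp] lemma hx_coe (a : ℝ) : hx (a : Bdry) = a := rfl
@[simp] lemma hy_coe (a : ℝ) : hy (a : Bdry) = 1 := rfl
@[simp] lemma hx_infty : hx ∞ = 1 := rfl
@[simp] lemma hy_infty : hy ∞ = 0 := rfl

lemma clockwise_coe (a b c : ℝ) :
    Clockwise (a : Bdry) (b : Bdry) (c : Bdry) ↔ 0 < (b - a) * (c - b) * (a - c) := Iff.rfl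
@[simp] lemma clockwise_coe_coe_infty (a b : ℝ) : Clockwise (a : Bdry) (b : Bdry) ∞ ↔ b < a :=
  Iff.rfl
@[simp] lemma clockwise_coe_infty_coe (a c : ℝ) : Clockwise (a : Bdry) ∞ (c : Bdry) ↔ a < c :=
  Iff.rfl
@[simp] lemma clockwise_infty_coe_coe (b c : ℝ) : Clockwise ∞ (b : Bdry) (c : Bdry) ↔ c < b :=
  Iff.rfl

lemma mem_rightOf_coe (a b : ℝ) (z : ℍ) : z ∈ rightOf (a : Bdry) (b : Bdry) ↔
    (b - a) * ((z.re - a) * (z.re - b) + z.im ^ 2) < 0 := Iff.rfl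
@[simp] lemma mem_rightOf_coe_infty (a : ℝ) (z : ℍ) : z ∈ rightOf (a : Bdry) ∞ ↔ a < z.re :=
  Iff.rfl
@[simp] lemma mem_rightOf_infty_coe (b : ℝ) (z : ℍ) : z ∈ rightOf ∞ (b : Bdry) ↔ z.re < b :=
  Iff.rfl
lemma mem_geodesic_coe (a b : ℝ) (z : ℍ) : z ∈ geodesic (a : Bdry) (b : Bdry) ↔
    (z.re - a) * (z.re - b) + z.im ^ 2 = 0 := Iff.rfl
@[simp] lemma mem_geodesic_coe_infty (a : ℝ) (z : ℍ) : z ∈ geodesic (a : Bdry) ∞ ↔ z.re = a :=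
  Iff.rfl
@[simp] lemma mem_geodesic_infty_coe (b : ℝ) (z : ℍ) : z ∈ geodesic ∞ (b : Bdry) ↔ z.re = b :=
  Iff.rfl
@[simp] lemma geodesic_infty_infty : geodesic ∞ ∞ = ∅ := rfl

@[simp] lemma not_clockwise_infty_infty_left (C : Bdry) : ¬ Clockwise ∞ ∞ C := id
@[simp] lemma not_clockwise_infty_infty_right (A : Bdry) : ¬ Clockwise A ∞ ∞ := by
  rcases infty_or_coe A with rfl | ⟨a, rfl⟩ <;> exact id
@[simp] lemma not_clockwise_infty_coe_infty (B : Bdry) : ¬ Clockwise ∞ B ∞ := by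
  rcases infty_or_coe B with rfl | ⟨b, rfl⟩ <;> exact id

/-- The determinant of the homogeneous coordinates of two boundary points. -/
noncomputable def wedge (A B : Bdry) : ℝ := hx A * hy B - hy A * hx B

/-- The quadratic form whose sign tells the sides of the geodesic with endpoints `A`, `B`. -/
noncomputable def sideForm (A B : Bdry) (z : ℍ) : ℝ :=
  (z.re * hy A - hx A) * (z.re * hy B - hx B) + z.im ^ 2 * hy A * hy B

/-- Every point enters the product twice, so its sign does not depend on the choice of homogeneous
coordinates. This removes the special role of `∞` and makes Möbius invariance a determinant
identity. -/
lemma clockwise_iff_wedge (A B C : Bdry) :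
    Clockwise A B C ↔ wedge A B * wedge B C * wedge C A < 0 := by
  rcases infty_or_coe A with rfl | ⟨a, rfl⟩ <;>
    rcases infty_or_coe B with rfl | ⟨b, rfl⟩ <;>
    rcases infty_or_coe C with rfl | ⟨c, rfl⟩ <;>
    simp [wedge, clockwise_coe]
  rw [← neg_pos]
  ring_nf

lemma mem_rightOf_iff (A B : Bdry) (z : ℍ) :
    z ∈ rightOf A B ↔ wedge B A * sideForm A B z < 0 := by
  rcases infty_or_coe A with rfl | ⟨a, rfl⟩ <;>
    rcases infty_or_coe B with rfl | ⟨b, rfl⟩ <;>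
    simp [rightOf, wedge, sideForm]

lemma mem_geodesic_iff (A B : Bdry) (z : ℍ) : z ∈ geodesic A B ↔ sideForm A B z = 0 := by
  rcases infty_or_coe A with rfl | ⟨a, rfl⟩ <;>
    rcases infty_or_coe B with rfl | ⟨b, rfl⟩ <;>
    simp [geodesic, sideForm]
  all_goals constructor <;> intro h <;> linarith

lemma wedge_eq_zero_iff (A B : Bdry) : wedge A B = 0 ↔ A = B := by
  rcases infty_or_coe A with rfl | ⟨a, rfl⟩ <;>
    rcases infty_or_coe B with rfl | ⟨b, rfl⟩ <;>
    simp [wedge, sub_eq_zero]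

lemma wedge_swap (A B : Bdry) : wedge B A = - wedge A B := by
  simp only [wedge]; ring

lemma sideForm_swap (A B : Bdry) (z : ℍ) : sideForm B A z = sideForm A B z := by
  simp only [sideForm]; ring

lemma geodesic_swap (A B : Bdry) : geodesic B A = geodesic A B := by
  ext z; rw [mem_geodesic_iff, mem_geodesic_iff, sideForm_swap]

lemma continuous_sideForm (A B : Bdry) : Continuous (sideForm A B) := by
  unfold sideForm
  have h1 : Continuous UpperHalfPlane.re := UpperHalfPlane.continuous_re
  have h2 : Continuous UpperHalfPlane.im := UpperHalfPlane.continuous_im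
  fun_prop

lemma isOpen_rightOf (A B : Bdry) : IsOpen (rightOf A B) := by
  have : rightOf A B = {z | wedge B A * sideForm A B z < 0} := by
    ext z; exact mem_rightOf_iff A B z
  rw [this]
  exact isOpen_lt (continuous_const.mul (continuous_sideForm A B)) continuous_const

/-! ### The action of `SL(2, ℝ)` -/

lemma bdryAct_one (A : Bdry) : bdryAct 1 A = A := by simp [bdryAct]

lemma bdryAct_mul (g h : SL(2, ℝ)) (A : Bdry) : bdryAct (g * h) A = bdryAct g (bdryAct h A) := by
  simp [bdryAct, mul_smul]

@[simp] lemma bdryAct_inv_bdryAct (g : SL(2, ℝ)) (A : Bdry) : bdryAct g⁻¹ (bdryAct g A) = A := by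
  rw [← bdryAct_mul, inv_mul_cancel, bdryAct_one]

@[simp] lemma bdryAct_bdryAct_inv (g : SL(2, ℝ)) (A : Bdry) : bdryAct g (bdryAct g⁻¹ A) = A := by
  rw [← bdryAct_mul, mul_inv_cancel, bdryAct_one]

lemma bdryAct_injective (g : SL(2, ℝ)) : Function.Injective (bdryAct g) := fun A B h => by
  rw [← bdryAct_inv_bdryAct g A, h, bdryAct_inv_bdryAct]

@[simp] lemma bdryAct_inj (g : SL(2, ℝ)) {A B : Bdry} : bdryAct g A = bdryAct g B ↔ A = B :=
  (bdryAct_injective g).eq_iff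

lemma bdryAct_coe (g : SL(2, ℝ)) (x : ℝ) :
    bdryAct g (x : Bdry) = if g 1 0 * x + g 1 1 = 0 then ∞ else
      (((g 0 0 * x + g 0 1) / (g 1 0 * x + g 1 1) : ℝ) : Bdry) :=
  OnePoint.smul_some_eq_ite (g := Matrix.SpecialLinearGroup.toGL g) (k := x)

lemma bdryAct_infty (g : SL(2, ℝ)) :
    bdryAct g ∞ = if g 1 0 = 0 then ∞ else ((g 0 0 / g 1 0 : ℝ) : Bdry) :=
  OnePoint.smul_infty_eq_ite (Matrix.SpecialLinearGroup.toGL g)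

lemma det_eq_one (g : SL(2, ℝ)) : g 0 0 * g 1 1 - g 0 1 * g 1 0 = 1 := by
  have := g.det_coe
  rwa [Matrix.det_fin_two] at this

/-- Absorbs the cases of `∞` and of the pole of `g` into one scalar: the action is linear up to
scaling. -/
lemma exists_hx_bdryAct (g : SL(2, ℝ)) (A : Bdry) : ∃ μ : ℝ, μ ≠ 0 ∧
    hx (bdryAct g A) = μ * (g 0 0 * hx A + g 0 1 * hy A) ∧
    hy (bdryAct g A) = μ * (g 1 0 * hx A + g 1 1 * hy A) := by
  have hd := det_eq_one g
  rcases infty_or_coe A with rfl | ⟨x, rfl⟩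
  · rw [bdryAct_infty]
    split_ifs with h
    · have h0 : g 0 0 ≠ 0 := by rintro h0; simp [h0, h] at hd
      exact ⟨(g 0 0)⁻¹, by positivity, by simp [h0], by simp [h]⟩
    · exact ⟨(g 1 0)⁻¹, by positivity, by simp; field_simp, by simp [h]⟩
  · rw [bdryAct_coe]
    split_ifs with h
    · have h0 : g 0 0 * x + g 0 1 ≠ 0 := by
        rintro h0
        have : g 0 0 * (g 1 0 * x + g 1 1) - g 1 0 * (g 0 0 * x + g 0 1) = 1 := by linarith
        rw [h, h0] at this; simp at this
      exact ⟨(g 0 0 * x + g 0 1)⁻¹, by positivity, by simp [h0], by simp [h]⟩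
    · exact ⟨(g 1 0 * x + g 1 1)⁻¹, by positivity, by simp; field_simp, by simp [h]⟩

lemma coe_smul_eq (g : SL(2, ℝ)) (z : ℍ) :
    ((g • z : ℍ) : ℂ) = ((g 0 0 : ℂ) * z + (g 0 1 : ℂ)) / ((g 1 0 : ℂ) * z + (g 1 1 : ℂ)) :=
  UpperHalfPlane.coe_specialLinearGroup_apply g z

lemma denom_pos (g : SL(2, ℝ)) (z : ℍ) :
    0 < (g 1 0 * z.re + g 1 1) ^ 2 + (g 1 0 * z.im) ^ 2 := by
  have hd := det_eq_one g
  have hi := z.im_pos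
  by_cases h : g 1 0 = 0
  · have : g 1 1 ≠ 0 := by rintro h1; simp [h, h1] at hd
    rw [h]; simp; positivity
  · positivity

lemma re_im_smul (g : SL(2, ℝ)) (z : ℍ) :
    (g • z).re = ((g 0 0 * z.re + g 0 1) * (g 1 0 * z.re + g 1 1) + g 0 0 * g 1 0 * z.im ^ 2) /
      ((g 1 0 * z.re + g 1 1) ^ 2 + (g 1 0 * z.im) ^ 2) ∧
    (g • z).im = z.im / ((g 1 0 * z.re + g 1 1) ^ 2 + (g 1 0 * z.im) ^ 2) := by
  have hp := denom_pos g z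
  have hd := det_eq_one g
  have h1 : (g • z).re = ((g • z : ℍ) : ℂ).re := rfl
  have h2 : (g • z).im = ((g • z : ℍ) : ℂ).im := rfl
  rw [h1, h2, coe_smul_eq, Complex.div_re, Complex.div_im]
  simp only [Complex.normSq_apply, Complex.add_re, Complex.mul_re, Complex.ofReal_re,
    Complex.ofReal_im, Complex.add_im, Complex.mul_im, UpperHalfPlane.coe_re,
    UpperHalfPlane.coe_im]
  have e : (g 1 0 * z.re - 0 * z.im + g 1 1) * (g 1 0 * z.re - 0 * z.im + g 1 1) +
    (g 1 0 * z.im + 0 * z.re + 0) * (g 1 0 * z.im + 0 * z.re + 0) =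
    (g 1 0 * z.re + g 1 1) ^ 2 + (g 1 0 * z.im) ^ 2 := by ring
  rw [e]
  constructor
  · rw [← add_div]; congr 1; ring
  · rw [← sub_div]; congr 1; linear_combination z.im * hd

/-- The same factor `μ * ν` occurs in both quantities, so their product changes by a positive
factor; this is why `g` preserves sides of geodesics. -/
lemma exists_wedge_sideForm (g : SL(2, ℝ)) (A B : Bdry) : ∃ μ ν : ℝ, μ ≠ 0 ∧ ν ≠ 0 ∧
    wedge (bdryAct g A) (bdryAct g B) = μ * ν * wedge A B ∧
    ∀ z, sideForm (bdryAct g A) (bdryAct g B) (g • z) =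
      μ * ν * sideForm A B z / ((g 1 0 * z.re + g 1 1) ^ 2 + (g 1 0 * z.im) ^ 2) := by
  obtain ⟨μ, hμ, h1, h2⟩ := exists_hx_bdryAct g A
  obtain ⟨ν, hν, h3, h4⟩ := exists_hx_bdryAct g B
  have hd := det_eq_one g
  refine ⟨μ, ν, hμ, hν, ?_, fun z => ?_⟩
  · simp only [wedge, h1, h2, h3, h4]
    linear_combination μ * ν * (hx A * hy B - hy A * hx B) * hd
  · have hp := denom_pos g z
    obtain ⟨hr, hi⟩ := re_im_smul g z
    have ha : g 0 0 * g 1 1 = 1 + g 0 1 * g 1 0 := by linarith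
    set D := (g 1 0 * z.re + g 1 1) ^ 2 + (g 1 0 * z.im) ^ 2 with hD
    have key : ∀ x y : ℝ, ((g • z).re * (g 1 0 * x + g 1 1 * y) - (g 0 0 * x + g 0 1 * y)) =
        ((g 1 0 * z.re + g 1 1) * (z.re * y - x) + g 1 0 * z.im ^ 2 * y) / D := by
      intro x y
      rw [hr, eq_div_iff hp.ne', sub_mul, mul_right_comm, div_mul_cancel₀ _ hp.ne', hD]
      linear_combination (-x * (z.re * g 1 0 + g 1 1) + y * (z.re * (g 1 0 * z.re + g 1 1)
        + g 1 0 * z.im ^ 2)) * hd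
    have e : sideForm (bdryAct g A) (bdryAct g B) (g • z) = μ * ν *
        (((g • z).re * (g 1 0 * hx A + g 1 1 * hy A) - (g 0 0 * hx A + g 0 1 * hy A)) *
         ((g • z).re * (g 1 0 * hx B + g 1 1 * hy B) - (g 0 0 * hx B + g 0 1 * hy B)) +
         (g • z).im ^ 2 * (g 1 0 * hx A + g 1 1 * hy A) * (g 1 0 * hx B + g 1 1 * hy B)) := by
      simp only [sideForm, h1, h2, h3, h4]; ring
    rw [e, key, key, hi]
    simp only [sideForm]
    field_simp
    rw [hD]
    ring

@[simp] lemma clockwise_bdryAct (g : SL(2, ℝ)) {A B C : Bdry} :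
    Clockwise (bdryAct g A) (bdryAct g B) (bdryAct g C) ↔ Clockwise A B C := by
  obtain ⟨a, ha, ha1, ha2⟩ := exists_hx_bdryAct g A
  obtain ⟨b, hb, hb1, hb2⟩ := exists_hx_bdryAct g B
  obtain ⟨c, hc, hc1, hc2⟩ := exists_hx_bdryAct g C
  have hd := det_eq_one g
  rw [clockwise_iff_wedge, clockwise_iff_wedge]
  have : wedge (bdryAct g A) (bdryAct g B) * wedge (bdryAct g B) (bdryAct g C) *
      wedge (bdryAct g C) (bdryAct g A) =
      (a * b * c) ^ 2 * (wedge A B * wedge B C * wedge C A) := by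
    have e : ∀ X Y : Bdry, ∀ u v : ℝ, hx (bdryAct g X) = u * (g 0 0 * hx X + g 0 1 * hy X) →
        hy (bdryAct g X) = u * (g 1 0 * hx X + g 1 1 * hy X) →
        hx (bdryAct g Y) = v * (g 0 0 * hx Y + g 0 1 * hy Y) →
        hy (bdryAct g Y) = v * (g 1 0 * hx Y + g 1 1 * hy Y) →
        wedge (bdryAct g X) (bdryAct g Y) = u * v * wedge X Y := by
      intro X Y u v h1 h2 h3 h4
      simp only [wedge, h1, h2, h3, h4]
      linear_combination u * v * (hx X * hy Y - hy X * hx Y) * hd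
    rw [e A B a b ha1 ha2 hb1 hb2, e B C b c hb1 hb2 hc1 hc2, e C A c a hc1 hc2 ha1 ha2]
    ring
  rw [this]
  have hp : 0 < (a * b * c) ^ 2 := by positivity
  constructor <;> intro h <;> nlinarith

@[simp] lemma smul_mem_rightOf (g : SL(2, ℝ)) {A B : Bdry} {z : ℍ} :
    g • z ∈ rightOf (bdryAct g A) (bdryAct g B) ↔ z ∈ rightOf A B := by
  obtain ⟨μ, ν, hμ, hν, h1, h2⟩ := exists_wedge_sideForm g A B
  rw [mem_rightOf_iff, mem_rightOf_iff, h2, wedge_swap, h1, wedge_swap A B]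
  have hp := denom_pos g z
  have : -(μ * ν * wedge A B) * (μ * ν * sideForm A B z /
      ((g 1 0 * z.re + g 1 1) ^ 2 + (g 1 0 * z.im) ^ 2)) =
      ((μ * ν) ^ 2 / ((g 1 0 * z.re + g 1 1) ^ 2 + (g 1 0 * z.im) ^ 2)) *
        (-wedge A B * sideForm A B z) := by ring
  rw [this]
  have hp' : 0 < (μ * ν) ^ 2 / ((g 1 0 * z.re + g 1 1) ^ 2 + (g 1 0 * z.im) ^ 2) := by positivity
  exact ⟨fun h => neg_of_mul_neg_right h hp'.le, fun h => mul_neg_of_pos_of_neg hp' h⟩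

@[simp] lemma smul_mem_geodesic (g : SL(2, ℝ)) {A B : Bdry} {z : ℍ} :
    g • z ∈ geodesic (bdryAct g A) (bdryAct g B) ↔ z ∈ geodesic A B := by
  obtain ⟨μ, ν, hμ, hν, h1, h2⟩ := exists_wedge_sideForm g A B
  rw [mem_geodesic_iff, mem_geodesic_iff, h2]
  have hp := denom_pos g z
  simp [hμ, hν, hp.ne']

/-! ### Moving boundary points to standard position -/

/-- The Möbius transformation `x ↦ -1 / (x - a)`. -/
noncomputable def inversion (a : ℝ) : SL(2, ℝ) :=
  ⟨!![0, -1; 1, -a], by simp [Matrix.det_fin_two]⟩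

lemma exists_bdryAct_eq_infty (A : Bdry) : ∃ g : SL(2, ℝ), bdryAct g A = ∞ := by
  rcases infty_or_coe A with rfl | ⟨a, rfl⟩
  · exact ⟨1, bdryAct_one _⟩
  · refine ⟨inversion a, ?_⟩
    rw [bdryAct_coe]
    simp [inversion]

/-- The translation by `b`. -/
noncomputable def translation (b : ℝ) : SL(2, ℝ) :=
  ⟨!![1, b; 0, 1], by simp [Matrix.det_fin_two]⟩

lemma bdryAct_translation (b x : ℝ) : bdryAct (translation b) (x : Bdry) = ((x + b : ℝ) : Bdry) := by
  rw [bdryAct_coe]; simp [translation]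

lemma bdryAct_translation_infty (b : ℝ) : bdryAct (translation b) ∞ = ∞ := by
  rw [bdryAct_infty]; simp [translation]

lemma exists_bdryAct_eq_zero_infty {A B : Bdry} (h : A ≠ B) :
    ∃ g : SL(2, ℝ), bdryAct g A = ((0 : ℝ) : Bdry) ∧ bdryAct g B = ∞ := by
  obtain ⟨g, hg⟩ := exists_bdryAct_eq_infty B
  rcases infty_or_coe (bdryAct g A) with hA | ⟨a, hA⟩
  · exact absurd (bdryAct_injective g (hA.trans hg.symm)) h
  · refine ⟨translation (-a) * g, ?_, ?_⟩
    · rw [bdryAct_mul, hA, bdryAct_translation]; simp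
    · rw [bdryAct_mul, hg, bdryAct_translation_infty]

/-! ### The cyclic order of the boundary -/

lemma clockwise_coe_iff (a b c : ℝ) : Clockwise (a : Bdry) (b : Bdry) (c : Bdry) ↔
    (c < b ∧ b < a) ∨ (b < a ∧ a < c) ∨ (a < c ∧ c < b) := by
  rw [clockwise_coe]
  constructor
  · intro h
    have h1 : b ≠ a := by rintro rfl; simp at h
    have h2 : c ≠ b := by rintro rfl; simp at h
    have h3 : a ≠ c := by rintro rfl; simp at h
    rcases h1.lt_or_gt with h1 | h1 <;> rcases h2.lt_or_gt with h2 | h2 <;>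
      rcases h3.lt_or_gt with h3 | h3
    · linarith
    · exact Or.inl ⟨h2, h1⟩
    · exact Or.inr (Or.inl ⟨h1, h3⟩)
    · nlinarith [mul_pos (mul_pos (sub_pos.2 h1) (sub_pos.2 h2)) (sub_pos.2 h3)]
    · exact Or.inr (Or.inr ⟨h3, h2⟩)
    · nlinarith [mul_pos (mul_pos (sub_pos.2 h1) (sub_pos.2 h2)) (sub_pos.2 h3)]
    · nlinarith [mul_pos (mul_pos (sub_pos.2 h1) (sub_pos.2 h2)) (sub_pos.2 h3)]
    · linarith
  · rintro (⟨h1, h2⟩ | ⟨h1, h2⟩ | ⟨h1, h2⟩)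
    · nlinarith [mul_pos (mul_pos (sub_pos.2 h1) (sub_pos.2 h2)) (sub_pos.2 (h1.trans h2))]
    · nlinarith [mul_pos (mul_pos (sub_pos.2 h1) (sub_pos.2 h2)) (sub_pos.2 (h1.trans h2))]
    · nlinarith [mul_pos (mul_pos (sub_pos.2 h1) (sub_pos.2 h2)) (sub_pos.2 (h1.trans h2))]

lemma Clockwise.rotate {A B C : Bdry} (h : Clockwise A B C) : Clockwise B C A := by
  rw [clockwise_iff_wedge] at *; linarith

lemma Clockwise.not_swap {A B C : Bdry} (h : Clockwise A B C) : ¬ Clockwise B A C := by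
  rw [clockwise_iff_wedge] at *
  rw [wedge_swap A B, wedge_swap C A, wedge_swap B C]
  linarith

lemma Clockwise.ne {A B C : Bdry} (h : Clockwise A B C) : A ≠ B := by
  rintro rfl
  exact h.not_swap h

lemma clockwise_or {A B C : Bdry} (h1 : A ≠ B) (h2 : B ≠ C) (h3 : A ≠ C) :
    Clockwise A B C ∨ Clockwise B A C := by
  simp only [clockwise_iff_wedge]
  rw [wedge_swap A B, wedge_swap C A, wedge_swap B C]
  have h1 := mt (wedge_eq_zero_iff A B).1 h1
  have h2 := mt (wedge_eq_zero_iff B C).1 h2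
  have h3 := mt (wedge_eq_zero_iff C A).1 h3.symm
  rcases lt_or_gt_of_ne (mul_ne_zero (mul_ne_zero h1 h2) h3) with h | h
  · exact Or.inl h
  · right; linarith

lemma exists_clockwise_of_ncard {t : Set Bdry} (ht : t.ncard = 3) {A B : Bdry} (hAB : A ≠ B)
    (hA : A ∈ t) (hB : B ∈ t) :
    ∃ C, t = {A, B, C} ∧ (Clockwise A B C ∨ Clockwise B A C) := by
  have hfin : t.Finite := Set.finite_of_ncard_ne_zero (by omega)
  have hc : (t \ {A, B}).ncard = 1 := by
    rw [Set.ncard_sdiff (by rintro x (rfl | rfl) <;> assumption), ht, Set.ncard_pair hAB]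
  obtain ⟨C, hC⟩ := Set.ncard_eq_one.1 hc
  have hC' : C ∈ t \ {A, B} := by rw [hC]; rfl
  simp only [Set.mem_sdiff, Set.mem_insert_iff, Set.mem_singleton_iff, not_or] at hC'
  refine ⟨C, ?_, clockwise_or hAB (Ne.symm hC'.2.2) (Ne.symm hC'.2.1)⟩
  rw [← Set.union_sdiff_cancel (s := {A, B}) (t := t) (by rintro x (rfl | rfl) <;> assumption), hC]
  ext x; simp; tauto

lemma exists_clockwise_eq {t : Set Bdry} (ht : t.ncard = 3) :
    ∃ A B C, Clockwise A B C ∧ t = {A, B, C} := by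
  obtain ⟨A, B, C, h1, h2, h3, rfl⟩ := Set.ncard_eq_three.1 ht
  rcases clockwise_or h1 h3 h2 with h | h
  · exact ⟨A, B, C, h, rfl⟩
  · exact ⟨B, A, C, h, Set.insert_comm _ _ _⟩

/-- Only the three cyclic relabellings of a clockwise triple are clockwise, so the quantified
definitions of triangles reduce to three conditions. -/
lemma clockwise_triple {A B C X Y Z : Bdry} (h : Clockwise A B C)
    (hX : X ∈ ({A, B, C} : Set Bdry)) (hY : Y ∈ ({A, B, C} : Set Bdry))
    (hZ : Z ∈ ({A, B, C} : Set Bdry)) (h' : Clockwise X Y Z) :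
    (X = A ∧ Y = B ∧ Z = C) ∨ (X = B ∧ Y = C ∧ Z = A) ∨ (X = C ∧ Y = A ∧ Z = B) := by
  have n1 := h'.ne
  have n2 := h'.rotate.ne
  have n3 := h'.rotate.rotate.ne
  have k1 := h.not_swap
  have k2 := h.rotate.not_swap
  have k3 := h.rotate.rotate.not_swap
  rcases hX with rfl | rfl | rfl <;> rcases hY with rfl | rfl | rfl <;>
    rcases hZ with rfl | rfl | rfl <;> simp_all

lemma mem_openTriangle_iff {A B C : Bdry} (h : Clockwise A B C) {z : ℍ} :
    z ∈ openTriangle {A, B, C} ↔ z ∈ rightOf A B ∧ z ∈ rightOf B C ∧ z ∈ rightOf C A := by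
  constructor
  · intro hz
    exact ⟨hz A (by simp) B (by simp) C (by simp) h,
      hz B (by simp) C (by simp) A (by simp) h.rotate,
      hz C (by simp) A (by simp) B (by simp) h.rotate.rotate⟩
  · rintro ⟨h1, h2, h3⟩ X hX Y hY Z hZ hXYZ
    rcases clockwise_triple h hX hY hZ hXYZ with ⟨rfl, rfl, rfl⟩ | ⟨rfl, rfl, rfl⟩ | ⟨rfl, rfl, rfl⟩ <;>
      assumption

lemma mem_closedTriangle_iff {A B C : Bdry} (h : Clockwise A B C) {z : ℍ} :
    z ∈ closedTriangle {A, B, C} ↔ z ∉ rightOf B A ∧ z ∉ rightOf C B ∧ z ∉ rightOf A C := by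
  constructor
  · intro hz
    exact ⟨hz A (by simp) B (by simp) C (by simp) h,
      hz B (by simp) C (by simp) A (by simp) h.rotate,
      hz C (by simp) A (by simp) B (by simp) h.rotate.rotate⟩
  · rintro ⟨h1, h2, h3⟩ X hX Y hY Z hZ hXYZ
    rcases clockwise_triple h hX hY hZ hXYZ with ⟨rfl, rfl, rfl⟩ | ⟨rfl, rfl, rfl⟩ | ⟨rfl, rfl, rfl⟩ <;>
      assumption

/-! ### Nested arcs -/

/-- The arc to the right of `P' → Q'` is contained in the arc to the right of `P → Q`. -/
def Nested (P Q P' Q' : Bdry) : Prop :=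
  P ≠ Q ∧ P' ≠ Q' ∧ (P' = P ∨ (Clockwise P Q P' ∧ Clockwise Q' P' P)) ∧
    (Q' = Q ∨ (Clockwise P Q Q' ∧ Clockwise Q' P' Q))

@[simp] lemma nested_bdryAct (g : SL(2, ℝ)) {P Q P' Q' : Bdry} :
    Nested (bdryAct g P) (bdryAct g Q) (bdryAct g P') (bdryAct g Q') ↔ Nested P Q P' Q' := by
  simp [Nested]

/-- In standard position nesting of arcs is inclusion of intervals, so the cyclic order is replaced
by the order of `ℝ`. -/
lemma nested_coe_infty_iff (p : ℝ) (P' Q' : Bdry) : Nested (p : Bdry) ∞ P' Q' ↔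
    ∃ p' : ℝ, P' = (p' : Bdry) ∧ p ≤ p' ∧ (Q' = ∞ ∨ ∃ q' : ℝ, Q' = (q' : Bdry) ∧ p' < q') := by
  rcases infty_or_coe P' with rfl | ⟨p', rfl⟩ <;> rcases infty_or_coe Q' with rfl | ⟨q', rfl⟩ <;>
    simp [Nested, clockwise_coe_iff] <;> grind

lemma nested_coe_coe_iff (p q : ℝ) (h : p < q) (P' Q' : Bdry) : Nested (p : Bdry) (q : Bdry) P' Q' ↔
    ∃ p' q' : ℝ, P' = (p' : Bdry) ∧ Q' = (q' : Bdry) ∧ p ≤ p' ∧ p' < q' ∧ q' ≤ q := by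
  rcases infty_or_coe P' with rfl | ⟨p', rfl⟩ <;> rcases infty_or_coe Q' with rfl | ⟨q', rfl⟩ <;>
    simp [Nested, clockwise_coe_iff] <;> grind

lemma nested_refl {P Q : Bdry} (h : P ≠ Q) : Nested P Q P Q := ⟨h, h, Or.inl rfl, Or.inl rfl⟩

lemma nested_left {P Q V : Bdry} (h : Clockwise P Q V) : Nested P Q V Q :=
  ⟨h.ne, h.rotate.ne.symm, Or.inr ⟨h, h.rotate⟩, Or.inl rfl⟩

lemma nested_right {P Q V : Bdry} (h : Clockwise P Q V) : Nested P Q P V :=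
  ⟨h.ne, h.rotate.rotate.ne.symm, Or.inl rfl, Or.inr ⟨h, h.rotate.rotate⟩⟩

/-- The complementary arcs are nested the other way round. Statements about right endpoints thereby
follow from those about left endpoints. -/
lemma Nested.swap {P Q P' Q' : Bdry} (h : Nested P Q P' Q') : Nested Q' P' Q P := by
  obtain ⟨h1, h2, h3, h4⟩ := h
  refine ⟨h2.symm, h1.symm, ?_, ?_⟩
  · rcases h4 with h4 | ⟨h4, h5⟩
    · exact Or.inl h4.symm
    · exact Or.inr ⟨h5, h4⟩
  · rcases h3 with h3 | ⟨h3, h5⟩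
    · exact Or.inl h3.symm
    · exact Or.inr ⟨h5, h3⟩

/-- Any two boundary points can be moved to a real number and `∞`. -/
lemma exists_bdryAct_coe_infty {P Q : Bdry} (h : P ≠ Q) :
    ∃ g : SL(2, ℝ), ∃ p : ℝ, bdryAct g P = (p : Bdry) ∧ bdryAct g Q = ∞ := by
  obtain ⟨g, h1, h2⟩ := exists_bdryAct_eq_zero_infty h
  exact ⟨g, 0, h1, h2⟩

/-- Endpoints move monotonically as arcs shrink, so one that is back at its initial position has
never moved. -/
lemma Nested.chain {P Q P₁ Q₁ P₂ Q₂ : Bdry} (h₁ : Nested P Q P₁ Q₁) (h₂ : Nested P₁ Q₁ P₂ Q₂) :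
    Nested P Q P₂ Q₂ ∧ (P₂ = P → P₁ = P ∧ P₂ = P₁) := by
  obtain ⟨g, p, hp, hq⟩ := exists_bdryAct_coe_infty h₁.1
  rw [← nested_bdryAct g] at *
  rw [← bdryAct_inj g, ← bdryAct_inj g (A := P₁), ← bdryAct_inj g (A := P₂) (B := P₁)]
  generalize bdryAct g P = P at *
  generalize bdryAct g Q = Q at *
  generalize bdryAct g P₁ = P₁ at *
  generalize bdryAct g Q₁ = Q₁ at *
  generalize bdryAct g P₂ = P₂ at *
  generalize bdryAct g Q₂ = Q₂ at *
  subst hp hq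
  rw [nested_coe_infty_iff] at *
  obtain ⟨p₁, rfl, h3, rfl | ⟨q₁, rfl, h4⟩⟩ := h₁
  · rw [nested_coe_infty_iff] at h₂
    obtain ⟨p₂, rfl, h5, h6⟩ := h₂
    refine ⟨⟨p₂, rfl, h3.trans h5, h6⟩, ?_⟩
    simp only [OnePoint.coe_eq_coe]
    rintro rfl
    exact ⟨le_antisymm h5 h3, le_antisymm h3 h5⟩
  · rw [nested_coe_coe_iff _ _ h4] at h₂
    obtain ⟨p₂, q₂, rfl, rfl, h5, h6, h7⟩ := h₂
    refine ⟨⟨p₂, rfl, h3.trans h5, Or.inr ⟨_, rfl, h6⟩⟩, ?_⟩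
    simp only [OnePoint.coe_eq_coe]
    rintro rfl
    exact ⟨le_antisymm h5 h3, le_antisymm h3 h5⟩

lemma Nested.trans {P Q P₁ Q₁ P₂ Q₂ : Bdry} (h₁ : Nested P Q P₁ Q₁) (h₂ : Nested P₁ Q₁ P₂ Q₂) :
    Nested P Q P₂ Q₂ := (h₁.chain h₂).1

lemma Nested.left_eq {P Q P₁ Q₁ P₂ Q₂ : Bdry} (h₁ : Nested P Q P₁ Q₁) (h₂ : Nested P₁ Q₁ P₂ Q₂)
    (h : P₂ = P) : P₁ = P := ((h₁.chain h₂).2 h).1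

lemma Nested.right_eq {P Q P₁ Q₁ P₂ Q₂ : Bdry} (h₁ : Nested P Q P₁ Q₁) (h₂ : Nested P₁ Q₁ P₂ Q₂)
    (h : Q₂ = Q) : Q₁ = Q := by
  have := ((h₂.swap.chain h₁.swap).2 h.symm)
  rw [this.1, h]

lemma Nested.rightOf_subset {P Q P' Q' : Bdry} (h : Nested P Q P' Q') :
    rightOf P' Q' ⊆ rightOf P Q := by
  obtain ⟨g, p, hp, hq⟩ := exists_bdryAct_coe_infty h.1
  intro z hz
  rw [← nested_bdryAct g] at h
  rw [← smul_mem_rightOf g] at *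
  generalize bdryAct g P = P at *
  generalize bdryAct g Q = Q at *
  generalize bdryAct g P' = P' at *
  generalize bdryAct g Q' = Q' at *
  generalize g • z = z at *
  subst hp hq
  rw [nested_coe_infty_iff] at *
  obtain ⟨p₁, rfl, h3, rfl | ⟨q₁, rfl, h4⟩⟩ := h
  · simp at *; linarith
  · rw [mem_rightOf_coe] at hz
    simp
    by_contra hc
    have : 0 < z.im ^ 2 := by have := z.im_pos; positivity
    nlinarith [mul_nonneg (show 0 ≤ p₁ - z.re by linarith) (show 0 ≤ q₁ - z.re by linarith)]

/-- Two geodesics that do not cross are nested, up to their orientation. -/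
lemma nested_of_not_cross {A B X Y : Bdry} (hAB : A ≠ B) (hXY : X ≠ Y)
    (h1 : ¬ (Clockwise A B X ∧ Clockwise B A Y)) (h2 : ¬ (Clockwise A B Y ∧ Clockwise B A X)) :
    Nested A B X Y ∨ Nested A B Y X ∨ Nested B A X Y ∨ Nested B A Y X := by
  obtain ⟨g, p, hp, hq⟩ := exists_bdryAct_coe_infty hAB
  rw [← clockwise_bdryAct g, ← clockwise_bdryAct g (A := B)] at h1 h2
  rw [← nested_bdryAct g, ← nested_bdryAct g (P' := Y), ← nested_bdryAct g (P := B),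
    ← nested_bdryAct g (P := B) (P' := Y)]
  rw [Ne, ← bdryAct_inj g] at hXY
  generalize bdryAct g A = A at *
  generalize bdryAct g B = B at *
  generalize bdryAct g X = X at *
  generalize bdryAct g Y = Y at *
  subst hp hq
  rcases infty_or_coe X with rfl | ⟨x, rfl⟩ <;> rcases infty_or_coe Y with rfl | ⟨y, rfl⟩ <;>
    simp [Nested, clockwise_coe_iff] at * <;> grind

/-- A geodesic inside the right-hand side of `P → Q` that does not cross the sides of the triangle
with vertices `P`, `Q`, `V` is one of its sides or lies behind one of its other two sides. -/
lemma Nested.step {P Q V P' Q' : Bdry} (hV : Clockwise P Q V) (h : Nested P Q P' Q')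
    (hne : ¬ (P' = P ∧ Q' = Q))
    (h1 : ¬ (Clockwise V Q P' ∧ Clockwise Q V Q')) (h2 : ¬ (Clockwise V Q Q' ∧ Clockwise Q V P'))
    (h3 : ¬ (Clockwise P V P' ∧ Clockwise V P Q')) (h4 : ¬ (Clockwise P V Q' ∧ Clockwise V P P')) :
    Nested V Q P' Q' ∨ Nested P V P' Q' := by
  obtain ⟨g, p, hp, hq⟩ := exists_bdryAct_coe_infty hV.rotate.rotate.ne.symm
  rw [← bdryAct_inj g, ← bdryAct_inj g (A := Q')] at hne
  rw [← clockwise_bdryAct g] at hV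
  rw [← clockwise_bdryAct g, ← clockwise_bdryAct g (A := Q)] at h1 h2
  rw [← clockwise_bdryAct g, ← clockwise_bdryAct g (A := V)] at h3 h4
  rw [← nested_bdryAct g] at h
  rw [← nested_bdryAct g, ← nested_bdryAct g (P := P)]
  generalize bdryAct g P = P at *
  generalize bdryAct g Q = Q at *
  generalize bdryAct g V = V at *
  generalize bdryAct g P' = P' at *
  generalize bdryAct g Q' = Q' at *
  subst hp hq
  rcases infty_or_coe Q with rfl | ⟨q, rfl⟩
  · simp at hV
  rcases infty_or_coe P' with rfl | ⟨x, rfl⟩ <;> rcases infty_or_coe Q' with rfl | ⟨y, rfl⟩ <;>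
    simp [Nested, clockwise_coe_iff] at * <;> grind

/-! ### Geodesics and triangles -/

lemma not_mem_rightOf_swap {A B : Bdry} {z : ℍ} (h : z ∈ rightOf A B) : z ∉ rightOf B A := by
  rw [mem_rightOf_iff] at *
  rw [wedge_swap B A, sideForm_swap A B]
  linarith

lemma not_mem_rightOf_of_mem_geodesic {A B : Bdry} {z : ℍ} (h : z ∈ geodesic A B) :
    z ∉ rightOf A B := by
  rw [mem_geodesic_iff] at h
  rw [mem_rightOf_iff, h]
  simp

lemma ne_of_mem_geodesic {A B : Bdry} {z : ℍ} (h : z ∈ geodesic A B) : A ≠ B := by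
  rintro rfl
  rcases infty_or_coe A with rfl | ⟨a, rfl⟩
  · simp at h
  · rw [mem_geodesic_coe] at h
    have := z.im_pos
    nlinarith [sq_nonneg (z.re - a)]

/-- The point `i √t` of the imaginary axis. -/
noncomputable def axisPoint (t : ℝ) (ht : 0 < t) : ℍ := ⟨⟨0, √t⟩, Real.sqrt_pos.2 ht⟩

lemma axisPoint_re (t : ℝ) (ht : 0 < t) : (axisPoint t ht).re = 0 := rfl

lemma axisPoint_im_sq (t : ℝ) (ht : 0 < t) : (axisPoint t ht).im ^ 2 = t := Real.sq_sqrt ht.le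

lemma geodesic_nonempty {A B : Bdry} (h : A ≠ B) : (geodesic A B).Nonempty := by
  obtain ⟨g, hA, hB⟩ := exists_bdryAct_eq_zero_infty h
  refine ⟨g⁻¹ • axisPoint 1 one_pos, ?_⟩
  rw [← smul_mem_geodesic g, smul_inv_smul, hA, hB]
  exact axisPoint_re _ _

lemma exists_tendsto_of_mem_geodesic {A B : Bdry} {z : ℍ} (h : z ∈ geodesic A B) :
    ∃ u : ℕ → ℍ, Tendsto u atTop (𝓝 z) ∧ ∀ n, u n ∈ rightOf A B := by
  obtain ⟨g, hA, hB⟩ := exists_bdryAct_eq_zero_infty (ne_of_mem_geodesic h)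
  refine ⟨fun n => g⁻¹ • ((1 / ((n : ℝ) + 1)) +ᵥ (g • z)), ?_, fun n => ?_⟩
  · have h1 : Tendsto (fun n : ℕ => (1 / ((n : ℝ) + 1)) +ᵥ (g • z)) atTop (𝓝 (g • z)) := by
      rw [UpperHalfPlane.isEmbedding_coe.tendsto_nhds_iff]
      have h2 : Tendsto (fun n : ℕ => (((1 / ((n : ℝ) + 1) : ℝ) : ℂ)) + ((g • z : ℍ) : ℂ)) atTop
          (𝓝 (((0 : ℝ) : ℂ) + ((g • z : ℍ) : ℂ))) :=
        ((Complex.continuous_ofReal.tendsto 0).comp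
          tendsto_one_div_add_atTop_nhds_zero_nat).add tendsto_const_nhds
      rw [Complex.ofReal_zero, zero_add] at h2
      exact h2
    have h3 := h1.const_smul g⁻¹
    rwa [inv_smul_smul] at h3
  · rw [← smul_mem_geodesic g, hA, hB, mem_geodesic_coe_infty] at h
    rw [← smul_mem_rightOf g, smul_inv_smul, hA, hB, mem_rightOf_coe_infty,
      UpperHalfPlane.vadd_re, h]
    positivity

lemma mem_closure_rightOf {A B : Bdry} {z : ℍ} (h : z ∈ geodesic A B) :
    z ∈ closure (rightOf A B) := by
  obtain ⟨u, h1, h2⟩ := exists_tendsto_of_mem_geodesic h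
  exact mem_closure_of_tendsto h1 (Eventually.of_forall h2)

/-- With `C` at `∞`, the side `A B` is a semicircle strictly between the two vertical sides. -/
lemma mem_rightOf_of_mem_geodesic {A B C : Bdry} (h : Clockwise A B C) {z : ℍ}
    (hz : z ∈ geodesic A B) : z ∈ rightOf B C ∧ z ∈ rightOf C A := by
  obtain ⟨g, hg⟩ := exists_bdryAct_eq_infty C
  rw [← clockwise_bdryAct g] at h
  rw [← smul_mem_geodesic g] at hz
  rw [← smul_mem_rightOf g, ← smul_mem_rightOf g (A := C), hg]
  rw [hg] at h
  generalize bdryAct g A = A at *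
  generalize bdryAct g B = B at *
  generalize g • z = z at *
  rcases infty_or_coe A with rfl | ⟨a, rfl⟩
  · simp at h
  rcases infty_or_coe B with rfl | ⟨b, rfl⟩
  · simp at h
  rw [clockwise_coe_coe_infty] at h
  rw [mem_geodesic_coe] at hz
  have h0 : 0 < z.im ^ 2 := by have := z.im_pos; positivity
  simp only [mem_rightOf_coe_infty, mem_rightOf_infty_coe]
  constructor <;> by_contra hc <;> nlinarith

/-- Once `Y → X` is the vertical line over `p`, the end `B` lies to the right of `p` and `A` is `∞`
or at least `p`. -/
lemma geodesic_subset_rightOf {X Y A B : Bdry} (hB : Clockwise Y X B)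
    (hA : ¬ Clockwise X Y A) {z : ℍ} (hz : z ∈ geodesic A B) : z ∈ rightOf Y X := by
  obtain ⟨g, p, hp, hq⟩ := exists_bdryAct_coe_infty hB.ne
  rw [← clockwise_bdryAct g, hp, hq] at hB hA
  rw [← smul_mem_geodesic g] at hz
  rw [← smul_mem_rightOf g, hp, hq]
  generalize bdryAct g A = A at *
  generalize bdryAct g B = B at *
  generalize g • z = z at *
  rcases infty_or_coe B with rfl | ⟨b, rfl⟩
  · simp at hB
  rw [clockwise_coe_infty_coe] at hB
  rw [mem_rightOf_coe_infty]
  rcases infty_or_coe A with rfl | ⟨a, rfl⟩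
  · rw [mem_geodesic_infty_coe] at hz
    linarith
  · rw [clockwise_infty_coe_coe] at hA
    rw [mem_geodesic_coe] at hz
    have h0 : 0 < z.im ^ 2 := by have := z.im_pos; positivity
    by_contra hc
    nlinarith

lemma isOpen_rightOf_inter₃ (A B C D E F : Bdry) :
    IsOpen (rightOf A B ∩ rightOf C D ∩ rightOf E F) :=
  ((isOpen_rightOf A B).inter (isOpen_rightOf C D)).inter (isOpen_rightOf E F)

lemma isOpen_openTriangle {A B C : Bdry} (h : Clockwise A B C) :
    IsOpen (openTriangle {A, B, C}) := by
  convert isOpen_rightOf_inter₃ A B B C C A using 1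
  ext z
  rw [mem_openTriangle_iff h]
  simp [and_assoc]

lemma mem_closure_openTriangle {A B C : Bdry} (h : Clockwise A B C) {z : ℍ}
    (hz : z ∈ geodesic A B) : z ∈ closure (openTriangle {A, B, C}) := by
  obtain ⟨u, h1, h2⟩ := exists_tendsto_of_mem_geodesic hz
  obtain ⟨h3, h4⟩ := mem_rightOf_of_mem_geodesic h hz
  refine mem_closure_of_tendsto h1 ?_
  filter_upwards [h1 ((isOpen_rightOf B C).mem_nhds h3), h1 ((isOpen_rightOf C A).mem_nhds h4)]
    with n h5 h6
  exact (mem_openTriangle_iff h).2 ⟨h2 n, h5, h6⟩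

lemma openTriangle_nonempty {A B C : Bdry} (h : Clockwise A B C) :
    (openTriangle {A, B, C}).Nonempty := by
  obtain ⟨z, hz⟩ := geodesic_nonempty h.ne
  exact closure_nonempty_iff.1 ⟨z, mem_closure_openTriangle h hz⟩

lemma geodesic_subset_closedTriangle {A B C : Bdry} (h : Clockwise A B C) :
    geodesic A B ⊆ closedTriangle {A, B, C} := by
  intro z hz
  obtain ⟨h3, h4⟩ := mem_rightOf_of_mem_geodesic h hz
  rw [mem_closedTriangle_iff h]
  refine ⟨not_mem_rightOf_of_mem_geodesic ?_, not_mem_rightOf_swap h3, not_mem_rightOf_swap h4⟩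
  rwa [geodesic_swap]

lemma isClosed_closedTriangle (t : Set Bdry) : IsClosed (closedTriangle t) := by
  have : closedTriangle t = ⋂ A ∈ t, ⋂ B ∈ t, ⋂ C ∈ t, ⋂ (_ : Clockwise A B C), (rightOf B A)ᶜ := by
    ext z; simp [closedTriangle]
  rw [this]
  refine isClosed_biInter fun A _ => isClosed_biInter fun B _ => isClosed_biInter fun C _ =>
    isClosed_iInter fun _ => (isOpen_rightOf B A).isClosed_compl

/-- A geodesic that crosses a side of an ideal triangle meets its interior. -/
lemma exists_mem_geodesic_openTriangle {A B X Y Z : Bdry} (hX : Clockwise A B X)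
    (hY : Clockwise B A Y) (hZ : Clockwise X Y Z) :
    ∃ z ∈ geodesic A B, z ∈ openTriangle {X, Y, Z} := by
  obtain ⟨g, hA, hB⟩ := exists_bdryAct_eq_zero_infty hX.ne
  suffices H : ∃ w : ℍ, w.re = 0 ∧ w ∈ rightOf (bdryAct g X) (bdryAct g Y) ∧
      w ∈ rightOf (bdryAct g Y) (bdryAct g Z) ∧ w ∈ rightOf (bdryAct g Z) (bdryAct g X) by
    obtain ⟨w, h0, h1, h2, h3⟩ := H
    refine ⟨g⁻¹ • w, ?_, ?_⟩
    · rw [← smul_mem_geodesic g, smul_inv_smul, hA, hB]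
      exact h0
    · rw [mem_openTriangle_iff hZ, ← smul_mem_rightOf g, ← smul_mem_rightOf g (A := Y),
        ← smul_mem_rightOf g (A := Z), smul_inv_smul]
      exact ⟨h1, h2, h3⟩
  rw [← clockwise_bdryAct g, hA, hB] at hX hY
  rw [← clockwise_bdryAct g] at hZ
  generalize bdryAct g X = X at *
  generalize bdryAct g Y = Y at *
  generalize bdryAct g Z = Z at *
  rcases infty_or_coe X with rfl | ⟨x, rfl⟩
  · simp at hX
  rcases infty_or_coe Y with rfl | ⟨y, rfl⟩
  · simp at hY
  rw [clockwise_coe_infty_coe] at hX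
  rw [clockwise_infty_coe_coe] at hY
  have hxy : 0 < -(x * y) := by nlinarith
  rcases infty_or_coe Z with rfl | ⟨z, rfl⟩
  · refine ⟨axisPoint (-(x * y) + 1) (by linarith), rfl, ?_, hY, hX⟩
    rw [mem_rightOf_coe, axisPoint_im_sq, axisPoint_re]
    nlinarith
  · rw [clockwise_coe_iff] at hZ
    rcases hZ with ⟨h1, h2⟩ | ⟨h1, h2⟩ | ⟨h1, h2⟩
    -- The imaginary axis meets the sides `X Y` and `Z X` at squared heights `-xy` and `-xz`; the
    -- witness has their mean as squared height. In the next case the second side is `Y Z`.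
    · have h3 : x * y > x * z := by nlinarith
      refine ⟨axisPoint (-(x * y + x * z) / 2) (by linarith), rfl, ?_, ?_, ?_⟩ <;>
        rw [mem_rightOf_coe, axisPoint_im_sq, axisPoint_re]
      · exact mul_neg_of_neg_of_pos (by linarith) (by linarith)
      · exact mul_neg_of_neg_of_pos (by linarith) (by nlinarith)
      · exact mul_neg_of_pos_of_neg (by linarith) (by linarith)
    · have h3 : y * x > y * z := by nlinarith
      refine ⟨axisPoint (-(x * y + y * z) / 2) (by linarith), rfl, ?_, ?_, ?_⟩ <;>
        rw [mem_rightOf_coe, axisPoint_im_sq, axisPoint_re]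
      · exact mul_neg_of_neg_of_pos (by linarith) (by linarith)
      · exact mul_neg_of_pos_of_neg (by linarith) (by linarith)
      · exact mul_neg_of_neg_of_pos (by linarith) (by nlinarith)
    · exfalso; linarith

/-! ### Combinatorics of ideal triangulations -/

variable {T : Set (Set Bdry)}

lemma IsEdge.symm {A B : Bdry} (h : IsEdge T A B) : IsEdge T B A :=
  ⟨h.1.symm, let ⟨t, ht, h1, h2⟩ := h.2; ⟨t, ht, h2, h1⟩⟩

lemma IsIdealTriangulation.finite_meeting (hT : IsIdealTriangulation T) {K : Set ℍ}
    (hK : IsCompact K) : {t ∈ T | (closedTriangle t ∩ K).Nonempty}.Finite := by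
  choose U hU hfin using hT.locallyFinite
  obtain ⟨s, -, hs⟩ := hK.elim_nhds_subcover U fun z _ => hU z
  refine (s.finite_toSet.biUnion fun z _ => hfin z).subset ?_
  rintro t ⟨ht, z, hz, hzK⟩
  obtain ⟨x, hx, hzx⟩ := Set.mem_iUnion₂.1 (hs hzK)
  exact Set.mem_iUnion₂.2 ⟨x, hx, ht, z, hz, hzx⟩

/-- A crossing edge enters the interior of a triangle with side `X Y`, and interior points of its
own triangle accumulate there. The two triangles then coincide, but `X` and `Y` would both have to
be the vertex opposite to `A B`. -/
lemma IsIdealTriangulation.not_cross (hT : IsIdealTriangulation T) {A B X Y : Bdry}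
    (hAB : IsEdge T A B) (hXY : IsEdge T X Y) : ¬ (Clockwise A B X ∧ Clockwise B A Y) := by
  suffices H : ∀ {A B X Y Z : Bdry}, IsEdge T A B → {X, Y, Z} ∈ T → Clockwise X Y Z →
      ¬ (Clockwise A B X ∧ Clockwise B A Y) by
    obtain ⟨hne, s, hs, hX, hY⟩ := hXY
    obtain ⟨Z, rfl, hZ | hZ⟩ := exists_clockwise_of_ncard (hT.card s hs) hne hX hY
    · exact H hAB hs hZ
    · rintro ⟨h1, h2⟩
      rw [Set.insert_comm] at hs
      obtain ⟨hAB1, t, ht, hA, hB⟩ := hAB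
      exact H ⟨hAB1.symm, t, ht, hB, hA⟩ hs hZ ⟨h2, h1⟩
  rintro A B X Y Z ⟨hne, t, ht, hA, hB⟩ hs hZ ⟨h1, h2⟩
  obtain ⟨z, hz, hzs⟩ := exists_mem_geodesic_openTriangle h1 h2 hZ
  obtain ⟨C, htC, hC⟩ := exists_clockwise_of_ncard (hT.card t ht) hne hA hB
  have hcl : z ∈ closure (openTriangle t) := by
    rcases hC with hC | hC
    · rw [htC]; exact mem_closure_openTriangle hC hz
    · rw [htC, Set.insert_comm]; exact mem_closure_openTriangle hC (by rwa [geodesic_swap])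
  obtain ⟨w, hw1, hw2⟩ := mem_closure_iff.1 hcl _ (isOpen_openTriangle hZ) hzs
  by_cases hst : {X, Y, Z} = t
  · have hX : X ∈ t := by rw [← hst]; simp
    have hY : Y ∈ t := by rw [← hst]; simp
    rw [htC] at hX hY
    have hXC : X = C := by
      rcases hX with h | h | h
      · exact absurd h.symm h1.rotate.rotate.ne.symm
      · exact absurd h.symm h1.rotate.ne
      · exact h
    have hYC : Y = C := by
      rcases hY with h | h | h
      · exact absurd h.symm h2.rotate.ne
      · exact absurd h.symm h2.rotate.rotate.ne.symm
      · exact h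
    exact hZ.ne (hXC.trans hYC.symm)
  · exact Set.disjoint_left.1 (hT.disj _ hs _ ht hst) hw1 hw2

/-- Just to the right of a point of the common side, the two open triangles overlap. -/
lemma IsIdealTriangulation.third_unique (hT : IsIdealTriangulation T) {A B C D : Bdry}
    (hC : Clockwise A B C) (hD : Clockwise A B D) (hCT : {A, B, C} ∈ T) (hDT : {A, B, D} ∈ T) :
    C = D := by
  obtain ⟨z, hz⟩ := geodesic_nonempty hC.ne
  obtain ⟨u, h1, h2⟩ := exists_tendsto_of_mem_geodesic hz
  obtain ⟨h3, h4⟩ := mem_rightOf_of_mem_geodesic hC hz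
  obtain ⟨h5, h6⟩ := mem_rightOf_of_mem_geodesic hD hz
  obtain ⟨n, ⟨k1, k2⟩, k3, k4⟩ := (((h1.eventually ((isOpen_rightOf B C).mem_nhds h3)).and
    (h1.eventually ((isOpen_rightOf C A).mem_nhds h4))).and
    ((h1.eventually ((isOpen_rightOf B D).mem_nhds h5)).and
    (h1.eventually ((isOpen_rightOf D A).mem_nhds h6)))).exists
  by_contra hne
  have hst : ({A, B, C} : Set Bdry) ≠ {A, B, D} := by
    intro h
    have : C ∈ ({A, B, D} : Set Bdry) := by rw [← h]; simp
    rcases this with h | h | h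
    · exact hC.rotate.rotate.ne h
    · exact hC.rotate.ne h.symm
    · exact hne h
  exact Set.disjoint_left.1 (hT.disj _ hCT _ hDT hst)
    ((mem_openTriangle_iff hC).2 ⟨h2 n, k1, k2⟩) ((mem_openTriangle_iff hD).2 ⟨h2 n, k3, k4⟩)

/-- The vertices cut the boundary circle into three open arcs, each behind one side of the triangle.
-/
lemma exists_clockwise_behind {s : Set Bdry} (hs : s.ncard = 3) {B : Bdry} (hB : B ∉ s) :
    ∃ X Y Z, Clockwise X Y Z ∧ s = {X, Y, Z} ∧ Clockwise Y X B := by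
  obtain ⟨X, Y, Z, h, rfl⟩ := exists_clockwise_eq hs
  simp only [Set.mem_insert_iff, Set.mem_singleton_iff, not_or] at hB
  by_cases h1 : Clockwise Y X B
  · exact ⟨X, Y, Z, h, rfl, h1⟩
  by_cases h2 : Clockwise Z Y B
  · exact ⟨Y, Z, X, h.rotate, by ext; simp; tauto, h2⟩
  by_cases h3 : Clockwise X Z B
  · exact ⟨Z, X, Y, h.rotate.rotate, by ext; simp; tauto, h3⟩
  exfalso
  obtain ⟨hX, hY, hZ⟩ := hB
  obtain ⟨g, hg⟩ := exists_bdryAct_eq_infty Z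
  rw [← clockwise_bdryAct g, hg] at h h2 h3
  rw [← clockwise_bdryAct g] at h1
  rw [← bdryAct_inj g] at hX hY hZ
  rw [hg] at hZ
  generalize bdryAct g X = X at *
  generalize bdryAct g Y = Y at *
  generalize bdryAct g B = B at *
  rcases infty_or_coe X with rfl | ⟨x, rfl⟩
  · simp at h
  rcases infty_or_coe Y with rfl | ⟨y, rfl⟩
  · simp at h
  rcases infty_or_coe B with rfl | ⟨b, rfl⟩
  · simp at hZ
  simp [clockwise_coe_iff] at *
  grind

/-- Every edge has a triangle on each of its sides. -/
lemma IsIdealTriangulation.exists_third (hT : IsIdealTriangulation T) {A B : Bdry}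
    (hAB : IsEdge T A B) : ∃ C, Clockwise A B C ∧ {A, B, C} ∈ T := by
  obtain ⟨z, hz⟩ := geodesic_nonempty hAB.1
  obtain ⟨u, h1, h2⟩ := exists_tendsto_of_mem_geodesic hz
  obtain ⟨U, hU, hfin⟩ := hT.locallyFinite z
  -- Finitely many closed triangles meet `U`, so those missing `z` also miss `u n` for large `n`. A
  -- triangle that covers such a `u n` thus contains `z`.
  have hev : ∀ᶠ n in atTop, ∀ t ∈ {t ∈ T | (closedTriangle t ∩ U).Nonempty},
      u n ∈ closedTriangle t → z ∈ closedTriangle t := by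
    refine (eventually_all_finite hfin).2 fun t _ => ?_
    by_cases hzt : z ∈ closedTriangle t
    · exact Eventually.of_forall fun n _ => hzt
    · filter_upwards [h1 ((isClosed_closedTriangle t).isOpen_compl.mem_nhds hzt)] with n hn hn'
      exact absurd hn' hn
  obtain ⟨n, hn, hnU⟩ := (hev.and (h1 hU)).exists
  obtain ⟨s, hs, hus⟩ := hT.cover (u n)
  have hzs := hn s ⟨hs, u n, hus, hnU⟩ hus
  -- If `B` were not a vertex of `s`, it would lie behind a side of `s`. As edges do not cross, the
  -- whole geodesic, including `z`, would lie there too.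
  have key : ∀ {A B : Bdry}, IsEdge T A B → z ∈ geodesic A B → B ∈ s := by
    intro A B hE hz
    by_contra hB
    obtain ⟨X, Y, Z, hZ, rfl, hYX⟩ := exists_clockwise_behind (hT.card s hs) hB
    have hXY : IsEdge T Y X := ⟨hZ.ne.symm, _, hs, by simp, by simp⟩
    have hA : ¬ Clockwise X Y A := fun h =>
      hT.not_cross hXY hE.symm ⟨hYX, h⟩
    exact ((mem_closedTriangle_iff hZ).1 hzs).1 (geodesic_subset_rightOf hYX hA hz)
  have hB : B ∈ s := key hAB hz
  have hA : A ∈ s := key hAB.symm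
    (by rwa [geodesic_swap])
  obtain ⟨C, rfl, hC | hC⟩ := exists_clockwise_of_ncard (hT.card s hs) hAB.1 hA hB
  · exact ⟨C, hC, hs⟩
  · rw [Set.insert_comm] at hus
    exact absurd (h2 n) ((mem_closedTriangle_iff hC).1 hus).1

/-- Passing from an oriented edge through the triangle on its right-hand side to another side of
that triangle. -/
def Step (T : Set (Set Bdry)) (E F : Bdry × Bdry) : Prop :=
  ∃ V, {E.1, E.2, V} ∈ T ∧ Clockwise E.1 E.2 V ∧ (F = (V, E.2) ∨ F = (E.1, V))

lemma Step.nested {E F : Bdry × Bdry} (h : Step T E F) : Nested E.1 E.2 F.1 F.2 := by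
  obtain ⟨V, -, hV, rfl | rfl⟩ := h
  · exact nested_left hV
  · exact nested_right hV

lemma nested_of_steps {e : ℕ → Bdry × Bdry} (h : ∀ n, Step T (e n) (e (n + 1))) {m n : ℕ}
    (hmn : m ≤ n) : Nested (e m).1 (e m).2 (e n).1 (e n).2 := by
  induction n, hmn using Nat.le_induction with
  | base => exact nested_refl (h m).nested.1
  | succ n _ ih => exact ih.trans (h n).nested

/-- An infinite sequence of steps does not stay in front of a fixed geodesic. -/
lemma IsIdealTriangulation.exists_not_nested (hT : IsIdealTriangulation T) {e : ℕ → Bdry × Bdry}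
    (h : ∀ n, Step T (e n) (e (n + 1))) (P' Q' : Bdry) :
    ∃ n, ¬ Nested (e n).1 (e n).2 P' Q' := by
  by_contra! hn
  obtain ⟨z₀, hz₀⟩ := geodesic_nonempty (hn 0).1
  obtain ⟨z₁, hz₁⟩ := geodesic_nonempty (hn 0).2.1
  -- If every arc contained the fixed one, the compact path `γ` from the first edge to the fixed
  -- geodesic would meet every edge of the chain, and so infinitely many triangles.
  obtain ⟨γ⟩ : Joined z₀ z₁ := PathConnectedSpace.joined z₀ z₁
  choose V hV hcw hstep using h
  -- The triangles are distinct because each later one lies behind the side through which the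
  -- earlier one is left.
  have hinj : Function.Injective fun n => ({(e n).1, (e n).2, V n} : Set Bdry) := by
    have hlt : ∀ m n, m < n →
        ({(e m).1, (e m).2, V m} : Set Bdry) ≠ {(e n).1, (e n).2, V n} := by
      intro m n hmn heq
      obtain ⟨z, hz⟩ := openTriangle_nonempty (hcw n)
      have h1 := (nested_of_steps (fun n => ⟨V n, hV n, hcw n, hstep n⟩)
        (Nat.succ_le_of_lt hmn)).rightOf_subset ((mem_openTriangle_iff (hcw n)).1 hz).1
      rw [← heq] at hz
      obtain ⟨h2, h3, h4⟩ := (mem_openTriangle_iff (hcw m)).1 hz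
      rcases hstep m with h5 | h5 <;> rw [Nat.succ_eq_add_one, h5] at h1
      · exact not_mem_rightOf_swap h1 h3
      · exact not_mem_rightOf_swap h1 h4
    intro m n hmn
    rcases lt_trichotomy m n with h | h | h
    · exact absurd hmn (hlt m n h)
    · exact h
    · exact absurd hmn.symm (hlt n m h)
  refine Set.infinite_of_injective_forall_mem hinj (fun n => ?_)
    (hT.finite_meeting (isCompact_range γ.continuous))
  refine ⟨hV n, ?_⟩
  have hN := nested_of_steps (fun n => ⟨V n, hV n, hcw n, hstep n⟩) (Nat.zero_le n)
  let f : ℍ → ℝ := fun z => wedge (e n).2 (e n).1 * sideForm (e n).1 (e n).2 z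
  have hf : Continuous f := continuous_const.mul (continuous_sideForm _ _)
  have h0 : 0 ≤ f z₀ := by
    by_contra hc
    exact not_mem_rightOf_of_mem_geodesic hz₀
      (hN.rightOf_subset ((mem_rightOf_iff _ _ _).2 (not_le.1 hc)))
  have h1 : f z₁ ≤ 0 := by
    have : closure (rightOf P' Q') ⊆ {z | f z ≤ 0} :=
      closure_minimal (fun z hz => ((mem_rightOf_iff _ _ _).1 ((hn n).rightOf_subset hz)).le)
        (isClosed_le hf continuous_const)
    exact this (mem_closure_rightOf hz₁)
  obtain ⟨z, ⟨s, rfl⟩, hz⟩ := (isPreconnected_range γ.continuous).intermediate_value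
    (Set.mem_range.2 ⟨1, γ.target⟩) (Set.mem_range.2 ⟨0, γ.source⟩) hf.continuousOn ⟨h1, h0⟩
  refine ⟨γ s, geodesic_subset_closedTriangle (hcw n) ?_, s, rfl⟩
  rw [mem_geodesic_iff]
  exact (mul_eq_zero.1 hz).resolve_left
    (mt (wedge_eq_zero_iff _ _).1 (hn n).1.symm)

/-! ### Convergence to the boundary -/

lemma tendsto_toSphere_coe_iff {ι : Type*} {f : ι → ℍ} {l : Filter ι} {x : ℝ} :
    Tendsto (fun t => toSphere (f t)) l (𝓝 (bdryToSphere (x : Bdry))) ↔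
      Tendsto (fun t => (f t : ℂ)) l (𝓝 (x : ℂ)) :=
  OnePoint.isOpenEmbedding_coe.isInducing.tendsto_nhds_iff.symm

lemma tendsto_toSphere_infty_iff {ι : Type*} {f : ι → ℍ} {l : Filter ι} :
    Tendsto (fun t => toSphere (f t)) l (𝓝 (bdryToSphere ∞)) ↔
      Tendsto (fun t => ‖(f t : ℂ)‖) l atTop := by
  rw [tendsto_norm_atTop_iff_cobounded, Metric.cobounded_eq_cocompact,
    ← coclosedCompact_eq_cocompact, ← OnePoint.comap_coe_nhds_infty, tendsto_comap_iff]
  rfl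

lemma tendsto_norm_affine {ι : Type*} {f : ι → ℂ} {l : Filter ι}
    (hf : Tendsto (fun t => ‖f t‖) l atTop) {c : ℂ} (hc : c ≠ 0) (d : ℂ) :
    Tendsto (fun t => ‖c * f t + d‖) l atTop := by
  have h1 : Tendsto (fun t => ‖c‖ * ‖f t‖ + -‖d‖) l atTop :=
    tendsto_atTop_add_const_right _ _ (hf.const_mul_atTop (norm_pos_iff.2 hc))
  refine tendsto_atTop_mono (fun t => ?_) h1
  have := norm_sub_le (c * f t + d) d
  rw [add_sub_cancel_right, norm_mul] at this
  linarith

lemma linear_ne_zero (g : SL(2, ℝ)) (z : ℍ) : (g 1 0 : ℂ) * z + (g 1 1 : ℂ) ≠ 0 := by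
  intro h
  have h1 := congrArg Complex.re h
  have h2 := congrArg Complex.im h
  have h3 := denom_pos g z
  simp at h1 h2
  rcases h2 with h2 | h2
  · rw [h1, h2] at h3
    simp at h3
  · exact z.im_pos.ne' h2

/-- Möbius maps extend continuously to the boundary; the cases are whether `α` and its image are
finite. Since `f` has values in `ℍ`, the denominators along it never vanish. -/
lemma tendsto_toSphere_smul {ι : Type*} {f : ι → ℍ} {l : Filter ι} {α : Bdry} (g : SL(2, ℝ))
    (hf : Tendsto (fun t => toSphere (f t)) l (𝓝 (bdryToSphere α))) :
    Tendsto (fun t => toSphere (g • f t)) l (𝓝 (bdryToSphere (bdryAct g α))) := by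
  have hd := det_eq_one g
  rcases infty_or_coe α with rfl | ⟨x, rfl⟩
  · rw [tendsto_toSphere_infty_iff] at hf
    rw [bdryAct_infty]
    split_ifs with h
    · rw [tendsto_toSphere_infty_iff]
      have h1 : g 1 1 ≠ 0 := by rintro h1; simp [h, h1] at hd
      have h0 : g 0 0 ≠ 0 := by rintro h1; simp [h, h1] at hd
      have h2 := tendsto_norm_affine hf (c := (g 0 0 : ℂ) / g 1 1)
        (by simp [h0, h1]) ((g 0 1 : ℂ) / g 1 1)
      refine h2.congr fun t => ?_
      rw [coe_smul_eq, h]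
      congr 1
      have : (g 1 1 : ℂ) ≠ 0 := by exact_mod_cast h1
      rw [Complex.ofReal_zero, zero_mul, zero_add]
      field_simp
    · rw [tendsto_toSphere_coe_iff]
      have hc : (g 1 0 : ℂ) ≠ 0 := by exact_mod_cast h
      have h2 := tendsto_norm_affine hf hc (g 1 1 : ℂ)
      have h3 : Tendsto (fun t => ((g 1 0 : ℂ) * f t + g 1 1)⁻¹) l (𝓝 0) := by
        rw [tendsto_zero_iff_norm_tendsto_zero]
        simp only [norm_inv]
        exact h2.inv_tendsto_atTop
      -- Since the determinant is 1, `(az + b)/(cz + d) = a/c - 1/(c(cz + d))`.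
      have h4 : Tendsto (fun t => (g 0 0 : ℂ) / g 1 0 -
          ((g 1 0 : ℂ) * f t + g 1 1)⁻¹ * (g 1 0 : ℂ)⁻¹) l
          (𝓝 ((g 0 0 : ℂ) / g 1 0 - 0 * (g 1 0 : ℂ)⁻¹)) :=
        tendsto_const_nhds.sub (h3.mul tendsto_const_nhds)
      rw [zero_mul, sub_zero, ← Complex.ofReal_div] at h4
      refine h4.congr fun t => ?_
      rw [coe_smul_eq]
      have h5 := linear_ne_zero g (f t)
      have hdc : (g 0 0 : ℂ) * g 1 1 - g 0 1 * g 1 0 = 1 := by exact_mod_cast hd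
      push_cast
      field_simp
      linear_combination hdc
  · rw [tendsto_toSphere_coe_iff] at hf
    have hn : Tendsto (fun t => (g 0 0 : ℂ) * f t + g 0 1) l (𝓝 (g 0 0 * x + g 0 1)) :=
      (hf.const_mul _).add_const _
    have hm : Tendsto (fun t => (g 1 0 : ℂ) * f t + g 1 1) l (𝓝 (g 1 0 * x + g 1 1)) :=
      (hf.const_mul _).add_const _
    rw [bdryAct_coe]
    split_ifs with h
    · rw [tendsto_toSphere_infty_iff]
      have hx : (g 0 0 : ℂ) * x + g 0 1 ≠ 0 := by
        intro h0
        have h0' : g 0 0 * x + g 0 1 = 0 := by exact_mod_cast h0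
        have : g 0 0 * (g 1 0 * x + g 1 1) - g 1 0 * (g 0 0 * x + g 0 1) = 1 := by linarith
        rw [h, h0'] at this; simp at this
      have h0 : (g 1 0 : ℂ) * x + g 1 1 = 0 := by exact_mod_cast h
      rw [h0] at hm
      have h1 : Tendsto (fun t => ‖(g 1 0 : ℂ) * f t + g 1 1‖) l (𝓝[>] 0) := by
        refine tendsto_nhdsWithin_iff.2 ⟨by simpa using hm.norm, Eventually.of_forall fun t => ?_⟩
        exact norm_pos_iff.2 (linear_ne_zero g (f t))
      refine (hn.norm.pos_mul_atTop (norm_pos_iff.2 hx)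
        (tendsto_inv_nhdsGT_zero.comp h1)).congr fun t => ?_
      rw [coe_smul_eq, norm_div, div_eq_mul_inv]
      rfl
    · rw [tendsto_toSphere_coe_iff]
      have h0 : (g 1 0 : ℂ) * x + g 1 1 ≠ 0 := by exact_mod_cast h
      push_cast
      refine (hn.div hm h0).congr fun t => ?_
      rw [coe_smul_eq]
      rfl

/-- A path that terminates at a boundary point adherent to a strictly smaller half plane finally
stays in the given half plane. -/
lemma Nested.eventually_mem_rightOf {P Q P' Q' α : Bdry} (h : Nested P Q P' Q') (hP : P' ≠ P)
    (hQ : Q' ≠ Q) {ι κ : Type*} {l : Filter ι} [l.NeBot] {f : ι → ℍ} {l' : Filter κ} {ζ : κ → ℍ}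
    (hf : Tendsto (fun t => toSphere (f t)) l (𝓝 (bdryToSphere α)))
    (hf' : ∀ᶠ t in l, f t ∈ rightOf P' Q')
    (hζ : Tendsto (fun t => toSphere (ζ t)) l' (𝓝 (bdryToSphere α))) :
    ∀ᶠ t in l', ζ t ∈ rightOf P Q := by
  obtain ⟨g, p, hp, hq⟩ := exists_bdryAct_coe_infty h.1
  rw [← nested_bdryAct g, hp, hq, nested_coe_infty_iff] at h
  obtain ⟨p', hp', hpp', h⟩ := h
  rw [Ne, ← bdryAct_inj g, hp, hp', OnePoint.coe_eq_coe] at hP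
  rw [Ne, ← bdryAct_inj g, hq] at hQ
  obtain ⟨q', hq', hpq⟩ := h.resolve_left hQ
  have hf1 := tendsto_toSphere_smul g hf
  have hζ1 := tendsto_toSphere_smul g hζ
  have hf2 : ∀ᶠ t in l, g • f t ∈ rightOf (p' : Bdry) (q' : Bdry) := by
    filter_upwards [hf'] with t ht
    rwa [← hp', ← hq', smul_mem_rightOf]
  have key : ∀ᶠ t in l', g • ζ t ∈ rightOf (p : Bdry) ∞ := by
    generalize bdryAct g α = α at *
    -- In standard position the smaller half plane is a bounded half-disc over `[p', q']`. So `α` is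
    -- finite and at least `p' > p`, and `ζ` finally has real part above `p`.
    have hbd : ∀ᶠ t in l, p' ≤ (g • f t).re ∧ (g • f t).re ≤ q' ∧ (g • f t).im ^ 2 ≤
        (q' - p') ^ 2 := by
      filter_upwards [hf2] with t ht
      rw [mem_rightOf_coe] at ht
      generalize g • f t = z at *
      have h1 := neg_of_mul_neg_right ht (by linarith)
      have h2 : 0 < z.im ^ 2 := by have := z.im_pos; positivity
      have h3 : p' ≤ z.re := by
        by_contra hc
        nlinarith
      have h4 : z.re ≤ q' := by
        by_contra hc
        nlinarith
      refine ⟨h3, h4, ?_⟩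
      nlinarith [mul_nonneg (sub_nonneg.2 h3) (sub_nonneg.2 h4)]
    rcases infty_or_coe α with rfl | ⟨x, rfl⟩
    · exfalso
      rw [tendsto_toSphere_infty_iff] at hf1
      obtain ⟨t, ⟨h1, h2, h3⟩, h4⟩ := (hbd.and
        (hf1.eventually_gt_atTop (|p'| + |q'| + (q' - p')))).exists
      have h5 := Complex.norm_le_abs_re_add_abs_im ((g • f t : ℍ) : ℂ)
      rw [UpperHalfPlane.coe_re, UpperHalfPlane.coe_im] at h5
      have h6 : |(g • f t).im| ≤ q' - p' := abs_le_of_sq_le_sq h3 (by linarith)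
      have h7 : |(g • f t).re| ≤ |p'| + |q'| := by
        rw [abs_le]
        constructor
        · linarith [neg_abs_le p', abs_nonneg q']
        · linarith [le_abs_self q', abs_nonneg p']
      linarith
    · rw [tendsto_toSphere_coe_iff] at hf1 hζ1
      have hr := (Complex.continuous_re.tendsto _).comp hf1
      have hr' := (Complex.continuous_re.tendsto _).comp hζ1
      have hx : p' ≤ x := by
        refine ge_of_tendsto hr ?_
        filter_upwards [hbd] with t ht using ht.1
      have hpx : p < x := lt_of_le_of_ne hpp' (Ne.symm hP) |>.trans_le hx
      filter_upwards [hr'.eventually_const_lt hpx] with t ht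
      exact ht
  filter_upwards [key] with t ht
  rwa [← smul_mem_rightOf g, hp, hq]

variable {Γ : Subgroup SL(2, ℝ)}

/-! ### The action on oriented edges -/

/-- The action on oriented edges. -/
noncomputable def pairAct (g : SL(2, ℝ)) (E : Bdry × Bdry) : Bdry × Bdry := (bdryAct g E.1, bdryAct g E.2)

lemma pairAct_mul (g h : SL(2, ℝ)) (E : Bdry × Bdry) :
    pairAct (g * h) E = pairAct g (pairAct h E) := by
  simp [pairAct, bdryAct_mul]

lemma pairAct_one (E : Bdry × Bdry) : pairAct 1 E = E := by
  simp [pairAct, bdryAct_one]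

lemma IsQuotientTriangulation.isEdge_bdryAct (hT : IsQuotientTriangulation Γ T) {g : SL(2, ℝ)}
    (hg : g ∈ Γ) {A B : Bdry} (h : IsEdge T A B) : IsEdge T (bdryAct g A) (bdryAct g B) := by
  obtain ⟨hne, t, ht, hA, hB⟩ := h
  exact ⟨fun h => hne (bdryAct_injective g h), _, hT.invariant g hg t ht,
    Set.mem_image_of_mem _ hA, Set.mem_image_of_mem _ hB⟩

lemma IsQuotientTriangulation.triangle_bdryAct (hT : IsQuotientTriangulation Γ T) {g : SL(2, ℝ)}
    (hg : g ∈ Γ) {A B C : Bdry} (h : {A, B, C} ∈ T) :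
    {bdryAct g A, bdryAct g B, bdryAct g C} ∈ T := by
  have := hT.invariant g hg _ h
  rwa [Set.image_insert_eq, Set.image_insert_eq, Set.image_singleton] at this

lemma IsQuotientTriangulation.step_pairAct (hT : IsQuotientTriangulation Γ T) {g : SL(2, ℝ)}
    (hg : g ∈ Γ) {E F : Bdry × Bdry} (h : Step T E F) : Step T (pairAct g E) (pairAct g F) := by
  obtain ⟨V, hV, hc, hF⟩ := h
  refine ⟨bdryAct g V, hT.triangle_bdryAct hg hV, (clockwise_bdryAct g).2 hc, ?_⟩
  rcases hF with rfl | rfl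
  · exact Or.inl rfl
  · exact Or.inr rfl

/-! ### An element fixing a vertex of an edge is parabolic -/

lemma bdryAct_coe_of_fixes_infty {g : SL(2, ℝ)} (h : g 1 0 = 0) (x : ℝ) :
    bdryAct g (x : Bdry) = ((g 0 0 ^ 2 * x + g 0 0 * g 0 1 : ℝ) : Bdry) := by
  have hd := det_eq_one g
  rw [h, mul_zero, sub_zero] at hd
  have h1 : g 1 1 ≠ 0 := by rintro h1; simp [h1] at hd
  rw [bdryAct_coe, h, zero_mul, zero_add, if_neg h1, OnePoint.coe_eq_coe, div_eq_iff h1]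
  linear_combination -(g 0 0 * x + g 0 1) * hd

/-- With `Q` at `∞` the edges are the vertical lines over `x k`. They all meet the compact set
formed by the points `x k + i` and their limit, which only finitely many triangles, hence finitely
many vertices, can serve. -/
lemma IsIdealTriangulation.not_accumulate (hT : IsIdealTriangulation T) (h : SL(2, ℝ)) {x : ℕ → ℝ}
    (hx : Function.Injective x) {x₀ : ℝ} (hlim : Tendsto x atTop (𝓝 x₀)) {P : ℕ → Bdry} {Q : Bdry}
    (hP : ∀ k, bdryAct h (P k) = (x k : Bdry)) (hQ : bdryAct h Q = ∞)
    (hE : ∀ k, IsEdge T (P k) Q) : False := by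
  let w : ℕ → ℍ := fun k => x k +ᵥ UpperHalfPlane.I
  have hw : Tendsto w atTop (𝓝 (x₀ +ᵥ UpperHalfPlane.I)) := by
    rw [UpperHalfPlane.isEmbedding_coe.tendsto_nhds_iff]
    exact ((Complex.continuous_ofReal.tendsto x₀).comp hlim).add tendsto_const_nhds
  have hfin := hT.finite_meeting (hw.const_smul h⁻¹).isCompact_insert_range
  have hP' : Function.Injective P := fun i j hij => by
    apply hx
    rw [← OnePoint.coe_eq_coe, ← hP, ← hP, hij]
  refine Set.infinite_of_injective_forall_mem hP' (fun k => ?_)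
    (hfin.biUnion (t := fun t => t) fun t ht =>
      Set.finite_of_ncard_ne_zero (by rw [hT.card t ht.1]; omega))
  obtain ⟨V, hV, hVT⟩ := hT.exists_third (hE k)
  refine Set.mem_biUnion (x := ({P k, Q, V} : Set Bdry)) ⟨hVT, h⁻¹ • w k, ?_, ?_⟩ (by simp)
  · apply geodesic_subset_closedTriangle hV
    rw [← smul_mem_geodesic h, smul_inv_smul, hP, hQ, mem_geodesic_coe_infty]
    simp [w]
  · exact Or.inr ⟨k, rfl⟩

/-- With `Q` at `∞`, `g` is an affine map with multiplier the square of its first diagonal entry. A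
multiplier below 1 would make the images of `P`, all joined to `Q` by edges, converge to the finite
fixed point `x₀`. -/
lemma IsQuotientTriangulation.not_contracting (hT : IsQuotientTriangulation Γ T) {g h : SL(2, ℝ)}
    (hg : g ∈ Γ) {P Q : Bdry} (hE : IsEdge T P Q) (hQ : bdryAct g Q = Q) (hP : bdryAct g P ≠ P)
    (hQ' : bdryAct h Q = ∞) : ¬ ((h * g * h⁻¹) 0 0) ^ 2 < 1 := by
  intro hr
  set g' := h * g * h⁻¹ with hg'
  have hinf : bdryAct g' ∞ = ∞ := by
    rw [hg', ← hQ', bdryAct_mul, bdryAct_mul, bdryAct_inv_bdryAct, hQ]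
  have hc : g' 1 0 = 0 := by
    by_contra hc
    rw [bdryAct_infty, if_neg hc] at hinf
    exact OnePoint.coe_ne_infty _ hinf
  obtain ⟨p, hp⟩ : ∃ p : ℝ, bdryAct h P = (p : Bdry) := by
    rcases infty_or_coe (bdryAct h P) with h1 | h1
    · exact absurd (bdryAct_injective h (h1.trans hQ'.symm)) hE.1
    · exact h1
  have hd := det_eq_one g'
  rw [hc, mul_zero, sub_zero] at hd
  have ha : g' 0 0 ≠ 0 := by rintro h1; simp [h1] at hd
  set r := g' 0 0 ^ 2
  have hr0 : 0 < r := by positivity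
  set x₀ := g' 0 0 * g' 0 1 / (1 - r) with hx₀
  have hx₀' : r * x₀ + g' 0 0 * g' 0 1 = x₀ := by
    have : 1 - r ≠ 0 := by linarith
    rw [hx₀]; field_simp; ring
  have hstep : ∀ Y : Bdry, bdryAct h (bdryAct g Y) = bdryAct g' (bdryAct h Y) := by
    intro Y
    rw [hg', bdryAct_mul, bdryAct_mul, bdryAct_inv_bdryAct]
  have hpx : p ≠ x₀ := by
    intro hpx
    apply hP
    apply bdryAct_injective h
    rw [hstep, hp, bdryAct_coe_of_fixes_infty hc, hpx, hx₀']
  have hPk : ∀ k : ℕ, bdryAct h (bdryAct (g ^ k) P) = ((x₀ + r ^ k * (p - x₀) : ℝ) : Bdry) ∧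
      IsEdge T (bdryAct (g ^ k) P) Q := by
    intro k
    induction k with
    | zero => simp [bdryAct_one, hp, hE]
    | succ k ih =>
      rw [pow_succ', bdryAct_mul]
      constructor
      · rw [hstep, ih.1, bdryAct_coe_of_fixes_infty hc, OnePoint.coe_eq_coe]
        linear_combination hx₀'
      · have := hT.isEdge_bdryAct hg ih.2
        rwa [hQ] at this
  refine hT.triangulation.not_accumulate h (x := fun k => x₀ + r ^ k * (p - x₀)) (x₀ := x₀) ?_ ?_
    (fun k => (hPk k).1) hQ' (fun k => (hPk k).2)
  · intro i j hij
    have h1 : r ^ i = r ^ j := by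
      have := add_left_cancel hij
      exact mul_right_cancel₀ (sub_ne_zero.2 hpx) this
    exact pow_right_injective₀ hr0 hr.ne h1
  · have h1 := ((tendsto_pow_atTop_nhds_zero_of_lt_one hr0.le hr).mul_const (p - x₀)).const_add x₀
    simpa using h1

/-- An element of the group that fixes one endpoint of an edge, but not the other, is parabolic. -/
lemma IsQuotientTriangulation.isParabolic_of_fixes (hT : IsQuotientTriangulation Γ T)
    {g : SL(2, ℝ)} (hg : g ∈ Γ) {P Q : Bdry} (hE : IsEdge T P Q) (hQ : bdryAct g Q = Q)
    (hP : bdryAct g P ≠ P) : (Matrix.SpecialLinearGroup.toGL g).IsParabolic := by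
  obtain ⟨h, hQ'⟩ := exists_bdryAct_eq_infty Q
  have h1 := hT.not_contracting hg hE hQ hP hQ'
  -- The multipliers of `g` and `g⁻¹` are both at least 1 and have product 1, so `g` is conjugate,
  -- up to sign, to a translation.
  have h2 := hT.not_contracting (inv_mem hg) hE (P := P) (Q := Q) (by
    conv_lhs => rw [← hQ]
    simp) (by
    intro h3
    apply hP
    conv_lhs => rw [← h3]
    simp) hQ'
  have hconj : h * g⁻¹ * h⁻¹ = (h * g * h⁻¹)⁻¹ := by group
  rw [hconj] at h2
  set g' := h * g * h⁻¹ with hg'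
  have hinf : bdryAct g' ∞ = ∞ := by
    rw [hg', ← hQ', bdryAct_mul, bdryAct_mul, bdryAct_inv_bdryAct, hQ]
  have hc : g' 1 0 = 0 := by
    by_contra hc
    rw [bdryAct_infty, if_neg hc] at hinf
    exact OnePoint.coe_ne_infty _ hinf
  have hd := det_eq_one g'
  rw [hc, mul_zero, sub_zero] at hd
  have h3 : (g'⁻¹) 0 0 = g' 1 1 := by
    rw [Matrix.SpecialLinearGroup.SL2_inv_expl]; rfl
  rw [h3] at h2
  have h4 : g' 0 0 ^ 2 * g' 1 1 ^ 2 = 1 := by rw [← mul_pow, hd, one_pow]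
  have h5 : g' 0 0 ^ 2 = 1 := by nlinarith
  have h6 : g' 1 1 = g' 0 0 := by
    have : g' 0 0 * (g' 1 1 - g' 0 0) = 0 := by linarith
    have ha : g' 0 0 ≠ 0 := by rintro h1; simp [h1] at hd
    linarith [(mul_eq_zero.1 this).resolve_left ha]
  have hpar : (Matrix.SpecialLinearGroup.toGL g').IsParabolic := by
    refine (Matrix.GeneralLinearGroup.isParabolic_iff_of_upperTriangular hc).2 ⟨h6.symm, ?_⟩
    intro h01
    apply hP
    apply bdryAct_injective h
    have e : bdryAct h (bdryAct g P) = bdryAct g' (bdryAct h P) := by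
      rw [hg', bdryAct_mul, bdryAct_mul, bdryAct_inv_bdryAct]
    rw [e]
    rcases infty_or_coe (bdryAct h P) with h7 | ⟨p, h7⟩
    · rw [h7, hinf]
    · have h01' : g' 0 1 = 0 := h01
      rw [h7, bdryAct_coe_of_fixes_infty hc, h5, h01']
      simp
  have hgg : Matrix.SpecialLinearGroup.toGL g' = Matrix.SpecialLinearGroup.toGL h *
      Matrix.SpecialLinearGroup.toGL g * (Matrix.SpecialLinearGroup.toGL h)⁻¹ := by
    rw [hg', map_mul, map_mul, map_inv]
  rw [hgg] at hpar
  exact (Matrix.GeneralLinearGroup.isParabolic_conj_iff _ _).1 hpar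

/-! ### The edges crossed by a closed curve -/

lemma Step.isEdge {E F : Bdry × Bdry} (h : Step T E F) : IsEdge T F.1 F.2 := by
  obtain ⟨V, hV, hc, rfl | rfl⟩ := h
  · exact ⟨hc.rotate.ne.symm, _, hV, by simp, by simp⟩
  · exact ⟨hc.rotate.rotate.ne.symm, _, hV, by simp, by simp⟩

lemma IsIdealTriangulation.exists_step (hT : IsIdealTriangulation T) {E E' : Bdry × Bdry}
    (hE : IsEdge T E.1 E.2) (hE' : IsEdge T E'.1 E'.2) (hN : Nested E.1 E.2 E'.1 E'.2)
    (hne : E' ≠ E) : ∃ F, Step T E F ∧ Nested F.1 F.2 E'.1 E'.2 := by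
  obtain ⟨V, hc, hV⟩ := hT.exists_third hE
  have h1 : IsEdge T V E.2 := Step.isEdge (E := E) (F := (V, E.2)) ⟨V, hV, hc, Or.inl rfl⟩
  have h2 : IsEdge T E.1 V := Step.isEdge (E := E) (F := (E.1, V)) ⟨V, hV, hc, Or.inr rfl⟩
  rcases hN.step hc (fun h => hne (Prod.ext h.1 h.2)) (hT.not_cross h1 hE')
    (hT.not_cross h1 hE'.symm) (hT.not_cross h2 hE') (hT.not_cross h2 hE'.symm) with h | h
  · exact ⟨(V, E.2), ⟨V, hV, hc, Or.inl rfl⟩, h⟩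
  · exact ⟨(E.1, V), ⟨V, hV, hc, Or.inr rfl⟩, h⟩

lemma exists_chain_of_reflTransGen {X : Type*} {r : X → X → Prop} {a b : X}
    (h : Relation.ReflTransGen r a b) :
    ∃ N : ℕ, ∃ e : ℕ → X, e 0 = a ∧ e N = b ∧ ∀ i < N, r (e i) (e (i + 1)) := by
  induction h with
  | refl => exact ⟨0, fun _ => a, rfl, rfl, by simp⟩
  | @tail b c _ hbc ih =>
    obtain ⟨N, e, h0, hN, hr⟩ := ih
    refine ⟨N + 1, fun i => if i ≤ N then e i else c, by simp [h0], by simp, fun i hi => ?_⟩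
    rcases Nat.lt_succ_iff_lt_or_eq.1 hi with h | rfl
    · simpa [h.le, Nat.succ_le_of_lt h] using hr i h
    · simpa [hN] using hbc

/-- Nested edges are connected by finitely many steps. -/
lemma IsIdealTriangulation.reflTransGen_step (hT : IsIdealTriangulation T) {E E' : Bdry × Bdry}
    (hE : IsEdge T E.1 E.2) (hE' : IsEdge T E'.1 E'.2) (hN : Nested E.1 E.2 E'.1 E'.2) :
    Relation.ReflTransGen (Step T) E E' := by
  -- Otherwise one could step towards `E'` forever, and all arcs of that infinite chain would
  -- contain the arc of `E'`.
  by_contra hno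
  let S := {F : Bdry × Bdry // Relation.ReflTransGen (Step T) E F ∧ IsEdge T F.1 F.2 ∧
    Nested F.1 F.2 E'.1 E'.2}
  have hnext : ∀ F : S, ∃ F' : S, Step T F.1 F'.1 := by
    rintro ⟨F, h1, h2, h3⟩
    obtain ⟨F', h4, h5⟩ := hT.exists_step h2 hE' h3 (by rintro rfl; exact hno h1)
    exact ⟨⟨F', h1.tail h4, h4.isEdge, h5⟩, h4⟩
  choose next hnext using hnext
  let s : ℕ → S := fun n => next^[n] ⟨E, .refl, hE, hN⟩
  have hs : ∀ n, Step T (s n).1 (s (n + 1)).1 := by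
    intro n
    simp only [s, Function.iterate_succ_apply']
    exact hnext _
  obtain ⟨n, hn⟩ := hT.exists_not_nested hs E'.1 E'.2
  exact hn (s n).2.2.2

/-- The finite chain from `E` to `gE` is a fundamental block: position `qN + i` of the infinite
chain carries `g ^ q` applied to the `i`-th edge of the block. -/
lemma IsQuotientTriangulation.exists_periodic_chain (hT : IsQuotientTriangulation Γ T)
    {g : SL(2, ℝ)} (hg : g ∈ Γ) {E : Bdry × Bdry} (hE : IsEdge T E.1 E.2)
    (hN : Nested E.1 E.2 (pairAct g E).1 (pairAct g E).2) (hne : pairAct g E ≠ E) :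
    ∃ N : ℕ, 1 ≤ N ∧ ∃ e : ℕ → Bdry × Bdry, e 0 = E ∧ (∀ n, Step T (e n) (e (n + 1))) ∧
      ∀ n, e (n + N) = pairAct g (e n) := by
  obtain ⟨N, e, h0, hN, hstep⟩ := exists_chain_of_reflTransGen
    (hT.triangulation.reflTransGen_step hE (hT.isEdge_bdryAct hg hE) hN)
  have hpos : 0 < N := by
    rcases Nat.eq_zero_or_pos N with rfl | h
    · exact absurd (hN.symm.trans h0) hne
    · exact h
  refine ⟨N, hpos, fun n => pairAct (g ^ (n / N)) (e (n % N)), ?_, fun n => ?_, fun n => ?_⟩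
  · simp [pairAct_one, h0]
  · beta_reduce
    have hmod := Nat.mod_lt n hpos
    have hq := Nat.div_add_mod n N
    rcases Nat.lt_or_ge (n % N + 1) N with h | h
    · have e1 : (n + 1) / N = n / N := by
        rw [Nat.div_eq_iff hpos, mul_comm]; omega
      have e2 : (n + 1) % N = n % N + 1 := by
        rw [Nat.add_mod, Nat.mod_eq_of_lt (a := 1) (by omega), Nat.mod_eq_of_lt h]
      rw [e1, e2]
      exact hT.step_pairAct (pow_mem hg _) (hstep _ hmod)
    · have h' : n % N + 1 = N := by omega
      have e0 : n + 1 = N * (n / N + 1) := by rw [mul_add]; omega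
      have e1 : (n + 1) / N = n / N + 1 := by rw [e0, Nat.mul_div_cancel_left _ hpos]
      have e2 : (n + 1) % N = 0 := by rw [e0, Nat.mul_mod_right]
      rw [e1, e2, h0, pow_succ, pairAct_mul, ← hN]
      have h2 := hT.step_pairAct (pow_mem hg (n / N)) (hstep _ hmod)
      rwa [h'] at h2
  · simp only [Nat.add_div_right n hpos, Nat.add_mod_right, pow_succ',
      pairAct_mul]

/-- The translate of the starting edge of a closed curve by the deck transformation lies strictly
behind the starting edge. -/
lemma ClosedCurve.nested_deck (c : ClosedCurve Γ) (hT : IsQuotientTriangulation Γ T) {P Q : Bdry}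
    (hE : IsEdge T P Q) (h0 : c.lift 0 ∈ geodesic P Q) (htop : ∀ᶠ t in atTop, c.lift t ∈ rightOf P Q)
    (hbot : ∀ᶠ t in atBot, c.lift t ∈ rightOf Q P) :
    Nested P Q (bdryAct c.deck P) (bdryAct c.deck Q) ∧
      ¬ (bdryAct c.deck P = P ∧ bdryAct c.deck Q = Q) := by
  have hE' := hT.isEdge_bdryAct c.deck_mem hE
  have hshift : ∀ {X Y : Bdry} {t : ℝ}, c.lift (t + -1) ∈ rightOf X Y ↔
      c.lift t ∈ rightOf (bdryAct c.deck X) (bdryAct c.deck Y) := by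
    intro X Y t
    rw [← smul_mem_rightOf c.deck, ← c.lift_add_one, neg_add_cancel_right]
  have htop' : ∀ᶠ t in atTop, c.lift (t + -1) ∈ rightOf P Q :=
    (tendsto_atTop_add_const_right _ (-1) tendsto_id).eventually htop
  have hbot' : ∀ᶠ t in atBot, c.lift (t + -1) ∈ rightOf Q P :=
    (tendsto_atBot_add_const_right _ (-1) tendsto_id).eventually hbot
  -- If `E` were behind `gE`, then `c (k + 1)` behind `E` would imply `c k` behind `E`. As `c 0`
  -- lies on `E`, no `c k` would ever be behind it.
  have hback : ¬ Nested (bdryAct c.deck P) (bdryAct c.deck Q) P Q := by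
    intro h
    obtain ⟨a, ha⟩ := eventually_atTop.1 htop
    obtain ⟨k, hk⟩ := exists_nat_ge a
    have : ∀ k : ℕ, c.lift k ∉ rightOf P Q := by
      intro k
      induction k with
      | zero => simpa using not_mem_rightOf_of_mem_geodesic h0
      | succ k ih =>
        intro hc
        apply ih
        have := hshift.2 (h.rightOf_subset hc)
        rwa [Nat.cast_succ, add_neg_cancel_right] at this
    exact this k (ha k hk)
  refine ⟨?_, fun h => hback (by rw [h.1, h.2]; exact nested_refl hE.1)⟩
  -- The two nestings with mismatched orientations put one end of the curve on both sides of `E`;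
  -- the last one is excluded by `hback`.
  rcases nested_of_not_cross hE.1 hE'.1 (hT.triangulation.not_cross hE hE')
    (hT.triangulation.not_cross hE hE'.symm) with h | h | h | h
  · exact h
  · obtain ⟨t, h1, h2⟩ := (hbot.and hbot').exists
    exact absurd (h.rightOf_subset (hshift.1 h2)) (not_mem_rightOf_swap h1)
  · obtain ⟨t, h1, h2⟩ := (htop.and htop').exists
    exact absurd (h.rightOf_subset (hshift.1 h2)) (not_mem_rightOf_swap h1)
  · exact absurd h.swap hback

lemma Step.ne_or_ne {E F : Bdry × Bdry} (h : Step T E F) : F.1 ≠ E.1 ∨ F.2 ≠ E.2 := by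
  obtain ⟨V, -, hc, rfl | rfl⟩ := h
  · exact Or.inl hc.rotate.rotate.ne
  · exact Or.inr hc.rotate.ne.symm

lemma Step.eq_or_eq {E F : Bdry × Bdry} (h : Step T E F) : F.1 = E.1 ∨ F.2 = E.2 := by
  obtain ⟨V, -, hc, rfl | rfl⟩ := h
  · exact Or.inr rfl
  · exact Or.inl rfl

/-- If a path is homotopic to a closed curve that leaves the starting edge `P → Q` on its right-hand
side, then it has a purely periodic cutting word containing both letters. -/
lemma exists_periodic_cuttingWord (hT : IsQuotientTriangulation Γ T) (c : ClosedCurve Γ)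
    (hc : ¬ c.IsPeripheral) {A B P Q α : Bdry} (hPQ : (P = A ∧ Q = B) ∨ (P = B ∧ Q = A))
    (hE : IsEdge T P Q) (h0 : c.lift 0 ∈ geodesic P Q) (htop : ∀ᶠ t in atTop, c.lift t ∈ rightOf P Q)
    (hbot : ∀ᶠ t in atBot, c.lift t ∈ rightOf Q P)
    (hlim : Tendsto (fun t => toSphere (c.lift t)) atTop (𝓝 (bdryToSphere α)))
    {ζ : C(ℝ≥0, ℍ)} (hend : TerminatesAt ζ α) :
    ∃ w, IsCuttingWord T A B ζ w ∧ (∃ N, 1 ≤ N ∧ ∀ n, w (n + N) = w n) ∧ (∃ n, w n = Letter.L) ∧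
      ∃ n, w n = Letter.R := by
  classical
  obtain ⟨hnest, hne⟩ := c.nested_deck hT hE h0 htop hbot
  obtain ⟨N, hN, e, he0, hstep, hper⟩ := hT.exists_periodic_chain c.deck_mem (E := (P, Q)) hE hnest
    (fun h => hne ⟨congrArg Prod.fst h, congrArg Prod.snd h⟩)
  have hedge : ∀ n, IsEdge T (e n).1 (e n).2 := by
    intro n
    cases n with
    | zero => rwa [he0]
    | succ n => exact (hstep n).isEdge
  -- Each step moves an endpoint, which cannot return, so the deck transformation moves at least one
  -- endpoint of `e n`. If it fixed the other, it would be parabolic.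
  have hmove : ∀ n, (e (n + N)).1 ≠ (e n).1 ∧ (e (n + N)).2 ≠ (e n).2 := by
    intro n
    have h1 : (e (n + N)).1 ≠ (e n).1 ∨ (e (n + N)).2 ≠ (e n).2 := by
      have k1 := nested_of_steps hstep (show n + 1 ≤ n + N by omega)
      rcases (hstep n).ne_or_ne with h | h
      · exact Or.inl fun h' => h ((hstep n).nested.left_eq k1 h')
      · exact Or.inr fun h' => h ((hstep n).nested.right_eq k1 h')
    rw [hper] at h1 ⊢
    constructor
    · intro h
      exact hc (hT.isParabolic_of_fixes c.deck_mem (hedge n).symm h (h1.resolve_left (not_not.2 h)))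
    · intro h
      exact hc (hT.isParabolic_of_fixes c.deck_mem (hedge n) h (h1.resolve_right (not_not.2 h)))
  have hev : ∀ n, ∀ᶠ t in atTop, c.lift t ∈ rightOf (e n).1 (e n).2 := by
    have hk : ∀ k : ℕ, ∀ᶠ t in atTop, c.lift t ∈ rightOf (e (k * N)).1 (e (k * N)).2 := by
      intro k
      induction k with
      | zero => simpa [he0] using htop
      | succ k ih =>
        have h1 := (tendsto_atTop_add_const_right _ (-1 : ℝ) tendsto_id).eventually ih
        filter_upwards [h1] with t ht
        rw [add_mul, one_mul, hper]
        have h2 := (smul_mem_rightOf c.deck).2 ht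
        rwa [← c.lift_add_one, id, neg_add_cancel_right] at h2
    intro n
    filter_upwards [hk n] with t ht
    exact (nested_of_steps hstep (Nat.le_mul_of_pos_right n hN)).rightOf_subset ht
  choose V hV hcw hcase using hstep
  have hstep : ∀ n, Step T (e n) (e (n + 1)) := fun n => ⟨V n, hV n, hcw n, hcase n⟩
  refine ⟨fun n => if (e (n + 1)).2 = (e n).2 then Letter.L else Letter.R,
    ⟨fun n => (e n).1, fun n => (e n).2, V, by simpa [he0] using hPQ, fun n => ?_,
      fun n => ⟨hV n, hcw n⟩, fun n => ?_⟩, ⟨N, hN, fun n => ?_⟩, ?_, ?_⟩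
  -- The curve ends behind the edge one period later, whose arc is smaller at both ends; this
  -- transfers to any path with the same terminal point.
  · exact (nested_of_steps hstep (Nat.le_add_right n N)).eventually_mem_rightOf (hmove n).1
      (hmove n).2 hlim (hev _) hend
  · rcases hcase n with h | h
    · left; simp [h]
    · right; simp [h, (hcw n).rotate.ne.symm]
  · have h1 : n + N + 1 = n + 1 + N := by omega
    simp only [h1, hper, pairAct, bdryAct_inj]
  -- Only `L` moves the left endpoint and only `R` the right one, so `hmove` forces both letters.
  · by_contra! hL
    have hR : ∀ n, (e n).1 = (e 0).1 := by
      intro n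
      induction n with
      | zero => rfl
      | succ n ih =>
        have h1 := hL n
        rw [ne_eq, ite_eq_left_iff] at h1
        rcases (hstep n).eq_or_eq with h | h
        · rw [h, ih]
        · exact absurd (fun h2 => absurd h h2) h1
    exact (hmove 0).1 (hR _)
  · by_contra! hL
    have hR : ∀ n, (e n).2 = (e 0).2 := by
      intro n
      induction n with
      | zero => rfl
      | succ n ih =>
        have h1 := hL n
        rw [ne_eq, ite_eq_right_iff] at h1
        by_contra h
        exact h1 fun h2 => absurd (h2.trans ih) h
    exact (hmove 0).2 (hR _)

/-! ### Periodic words and their exponents -/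

/-- The letter of the `i`-th block. -/
def blockLetter (i : ℕ) : Letter := if Even i then Letter.L else Letter.R

lemma blockLetter_succ_ne (i : ℕ) : blockLetter (i + 1) ≠ blockLetter i := by
  by_cases h : Even i <;> simp [blockLetter, Nat.even_add_one, h]

lemma blockLetter_add_of_even {s : ℕ} (hs : Even s) (i : ℕ) :
    blockLetter (i + s) = blockLetter i := by
  simp [blockLetter, Nat.even_add, hs]

lemma eq_blockLetter_succ {x : Letter} {i : ℕ} (h : x ≠ blockLetter i) : x = blockLetter (i + 1) := by
  by_cases hi : Even i <;> cases x <;> simp_all [blockLetter, Nat.even_add_one]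

/-- The position at which the `i`-th block starts. -/
def blockStart (a : ℕ → ℕ) (i : ℕ) : ℕ := ∑ j ∈ Finset.range i, a j

lemma blockStart_zero (a : ℕ → ℕ) : blockStart a 0 = 0 := Finset.sum_range_zero _

lemma blockStart_succ (a : ℕ → ℕ) (i : ℕ) : blockStart a (i + 1) = blockStart a i + a i :=
  Finset.sum_range_succ _ _

lemma hasExponents_iff {w : ℕ → Letter} {a : ℕ → ℕ} : HasExponents w a ↔
    (∀ i, 1 ≤ i → 0 < a i) ∧
      ∀ i k, blockStart a i ≤ k → k < blockStart a (i + 1) → w k = blockLetter i := Iff.rfl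

lemma exists_block {a : ℕ → ℕ} (ha : ∀ i, 1 ≤ i → 0 < a i) (k : ℕ) :
    ∃ i, blockStart a i ≤ k ∧ k < blockStart a (i + 1) := by
  have hle : ∀ i, i ≤ blockStart a (i + 1) := by
    intro i
    induction i with
    | zero => simp
    | succ i ih =>
      have := ha (i + 1) (by omega)
      rw [blockStart_succ]
      omega
  have hex : ∃ i, k < blockStart a i := ⟨k + 1 + 1, by have := hle (k + 1); omega⟩
  classical
  have h0 : Nat.find hex ≠ 0 := by
    intro h
    have := Nat.find_spec hex
    rw [h, blockStart_zero] at this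
    omega
  obtain ⟨i, hi⟩ := Nat.exists_eq_succ_of_ne_zero h0
  refine ⟨i, not_lt.1 (Nat.find_min hex (by omega)), ?_⟩
  rw [← Nat.succ_eq_add_one, ← hi]
  exact Nat.find_spec hex

/-- At the position where the shorter block ends, one reading demands the next letter and the other
still the old one; the next block is nonempty. -/
lemma HasExponents.not_blockStart_lt {w : ℕ → Letter} {a b : ℕ → ℕ} (ha : HasExponents w a)
    (hb : HasExponents w b) {i : ℕ} (h : blockStart a i = blockStart b i) :
    ¬ blockStart a (i + 1) < blockStart b (i + 1) := by
  intro hlt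
  have h1 := ha.1 (i + 1) (by omega)
  have h2 := ha.2 (i + 1) (blockStart a (i + 1)) le_rfl (by
    show _ < blockStart a (i + 1 + 1)
    rw [blockStart_succ a (i + 1)]; omega)
  have h3 := hb.2 i (blockStart a (i + 1)) (by
    show blockStart b i ≤ _
    rw [← h, blockStart_succ]; omega) hlt
  exact blockLetter_succ_ne i (h2.symm.trans h3)

lemma HasExponents.unique {w : ℕ → Letter} {a b : ℕ → ℕ} (ha : HasExponents w a)
    (hb : HasExponents w b) : a = b := by
  have h : ∀ i, blockStart a i = blockStart b i := by
    intro i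
    induction i with
    | zero => rw [blockStart_zero, blockStart_zero]
    | succ i ih =>
      exact le_antisymm (not_lt.1 (hb.not_blockStart_lt ha ih.symm))
        (not_lt.1 (ha.not_blockStart_lt hb ih))
  funext i
  have h1 := h (i + 1)
  rw [blockStart_succ, blockStart_succ, h i] at h1
  omega

lemma add_mul_of_periodic {X : Type*} {w : ℕ → X} {N : ℕ} (h : ∀ n, w (n + N) = w n) (n k : ℕ) :
    w (n + k * N) = w n := by
  induction k with
  | zero => simp
  | succ k ih => rw [add_mul, one_mul, ← add_assoc, h, ih]

lemma exists_hasExponents {w : ℕ → Letter} (h : ∀ (l : Letter) (m : ℕ), ∃ k ≥ m, w k = l) :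
    ∃ a, HasExponents w a := by
  classical
  have hex : ∀ i m, ∃ k, m ≤ k ∧ w k ≠ blockLetter i := by
    intro i m
    obtain ⟨k, hk, hw⟩ := h (blockLetter (i + 1)) m
    exact ⟨k, hk, by rw [hw]; exact blockLetter_succ_ne i⟩
  -- A block ends at the first position that does not carry its letter. Only block 0 can be empty,
  -- when the word begins with `R`.
  let b : ℕ → ℕ := fun i => Nat.rec (motive := fun _ => ℕ) 0 (fun i m => Nat.find (hex i m)) i
  have hb : ∀ i, b (i + 1) = Nat.find (hex i (b i)) := fun i => rfl
  have hspec : ∀ i, b i ≤ b (i + 1) ∧ w (b (i + 1)) ≠ blockLetter i := by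
    intro i
    rw [hb]
    exact Nat.find_spec (hex i (b i))
  have hS : ∀ i, blockStart (fun i => b (i + 1) - b i) i = b i := by
    intro i
    induction i with
    | zero => rfl
    | succ i ih =>
      have := (hspec i).1
      rw [blockStart_succ, ih]
      omega
  refine ⟨fun i => b (i + 1) - b i, hasExponents_iff.2 ⟨fun i hi => ?_, fun i k h1 h2 => ?_⟩⟩
  · obtain ⟨j, rfl⟩ := Nat.exists_eq_add_of_le' hi
    have h1 := eq_blockLetter_succ (hspec j).2
    have h2 := (hspec (j + 1)).2
    have h3 := (hspec (j + 1)).1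
    have h4 : b (j + 1) ≠ b (j + 1 + 1) := fun h4 => h2 (by rw [← h4]; exact h1)
    show 0 < b (j + 1 + 1) - b (j + 1)
    omega
  · rw [hS] at h1 h2
    rw [hb] at h2
    by_contra hc
    exact Nat.find_min (hex i (b i)) h2 ⟨h1, hc⟩

/-- Deleting `N` letters leaves the remainder of block `i₀` as new first block; it consists of `L`,
as required. -/
lemma HasExponents.shift_even {w : ℕ → Letter} {a : ℕ → ℕ} (ha : HasExponents w a) {i₀ N : ℕ}
    (hi : Even i₀) (h1 : blockStart a i₀ ≤ N) (h2 : N < blockStart a (i₀ + 1)) :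
    HasExponents (fun n => w (n + N))
      (fun j => if j = 0 then blockStart a (i₀ + 1) - N else a (i₀ + j)) := by
  set a' : ℕ → ℕ := fun j => if j = 0 then blockStart a (i₀ + 1) - N else a (i₀ + j) with ha'
  have hS : ∀ j, blockStart a' (j + 1) + N = blockStart a (i₀ + j + 1) := by
    intro j
    induction j with
    | zero =>
      rw [blockStart_succ, blockStart_zero]
      simp only [ha', if_true, add_zero]
      omega
    | succ j ih =>
      rw [blockStart_succ a' (j + 1), ← add_assoc i₀ j 1, blockStart_succ a (i₀ + j + 1), ← ih]
      simp only [ha', Nat.succ_ne_zero, if_false]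
      rw [← add_assoc i₀ j 1]
      omega
  refine hasExponents_iff.2 ⟨fun j hj => ?_, fun j k k1 k2 => ?_⟩
  · simp only [ha', if_neg (show j ≠ 0 by omega)]
    exact ha.1 _ (by omega)
  · have k3 := hS j
    have := ha.2 (i₀ + j) (k + N) ?_ (show _ < blockStart a (i₀ + j + 1) by omega)
    · rw [this]
      show blockLetter _ = _
      rw [add_comm, blockLetter_add_of_even hi]
    · show blockStart a _ ≤ _
      cases j with
      | zero => rw [add_zero]; omega
      | succ j => have k4 := hS j; rw [← add_assoc]; omega

/-- Here the remainder consists of `R`, so an empty block of `L` precedes it. This is the source of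
the second form in `ESP`. -/
lemma HasExponents.shift_odd {w : ℕ → Letter} {a : ℕ → ℕ} (ha : HasExponents w a) {i₀ N : ℕ}
    (hi : ¬ Even i₀) (h1 : blockStart a i₀ ≤ N) (h2 : N < blockStart a (i₀ + 1)) :
    HasExponents (fun n => w (n + N)) (fun j => if j = 0 then 0 else
      if j = 1 then blockStart a (i₀ + 1) - N else a (i₀ + j - 1)) := by
  set a' : ℕ → ℕ := fun j => if j = 0 then 0 else
      if j = 1 then blockStart a (i₀ + 1) - N else a (i₀ + j - 1) with ha'
  have hS : ∀ j, blockStart a' (j + 1 + 1) + N = blockStart a (i₀ + j + 1) := by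
    intro j
    induction j with
    | zero =>
      rw [blockStart_succ, blockStart_succ, blockStart_zero]
      simp only [ha', if_true, add_zero, zero_add, one_ne_zero, if_false]
      omega
    | succ j ih =>
      have e : a' (j + 1 + 1) = a (i₀ + j + 1) := by simp [ha', add_assoc]
      rw [blockStart_succ a' (j + 1 + 1), e,
        ← add_assoc i₀ j 1, blockStart_succ a (i₀ + j + 1), ← ih]
      omega
  refine hasExponents_iff.2 ⟨fun j hj => ?_, fun j k k1 k2 => ?_⟩
  · simp only [ha', if_neg (show j ≠ 0 by omega)]
    split_ifs with h
    · omega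
    · exact ha.1 _ (by omega)
  · match j, k1, k2 with
    | 0, k1, k2 =>
      rw [blockStart_succ, blockStart_zero] at k2
      simp [ha'] at k2
    | j + 1, k1, k2 =>
      have k3 := hS j
      have := ha.2 (i₀ + j) (k + N) ?_ (show _ < blockStart a (i₀ + j + 1) by omega)
      · rw [this]
        show blockLetter _ = _
        by_cases hj : Even j <;> simp [blockLetter, Nat.even_add, hi, hj]
      · show blockStart a _ ≤ _
        cases j with
        | zero => rw [add_zero]; omega
        | succ j => have k4 := hS j; rw [← add_assoc]; omega

/-- The exponents of a purely periodic word are essentially periodic. -/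
lemma HasExponents.eta_mem_ESPPlus {w : ℕ → Letter} {a : ℕ → ℕ} (ha : HasExponents w a) {N : ℕ}
    (hN : 1 ≤ N) (hw : ∀ n, w (n + N) = w n) : eta a ∈ ESPPlus := by
  refine ⟨⟨fun i hi => Int.natCast_pos.2 (ha.1 i hi), ?_⟩, Int.natCast_nonneg _⟩
  obtain ⟨i₀, h1, h2⟩ := exists_block ha.1 N
  have hw' : (fun n => w (n + N)) = w := funext hw
  have h3 := blockStart_succ a i₀
  by_cases hi : Even i₀
  · have h := ha.shift_even hi h1 h2
    rw [hw'] at h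
    have heq := ha.unique h
    have h0 : a 0 = blockStart a (i₀ + 1) - N := congrFun heq 0
    -- If `N` fell into block 0, its remainder would be shorter than `a 0`.
    have hpos : 1 ≤ i₀ := by
      rcases Nat.eq_zero_or_pos i₀ with rfl | h
      · rw [zero_add, blockStart_succ, blockStart_zero] at h0 h2
        omega
      · exact h
    refine Or.inl ⟨i₀, hpos, fun i hi1 => ?_, ?_⟩
    · have := congrFun heq i
      simp only [if_neg (show i ≠ 0 by omega)] at this
      rw [eta, eta, this, add_comm]
    · rw [eta, eta]
      omega
  · have h := ha.shift_odd hi h1 h2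
    rw [hw'] at h
    have heq := ha.unique h
    have h0 : a 0 = 0 := congrFun heq 0
    have h10 : a 1 = blockStart a (i₀ + 1) - N := congrFun heq 1
    have hodd := Nat.not_even_iff_odd.1 hi
    have hpos : 2 ≤ i₀ := by
      obtain ⟨m, rfl⟩ := hodd
      rcases Nat.eq_zero_or_pos m with rfl | h
      · have e : blockStart a (2 * 0 + 1) = a 0 := by simp [blockStart]
        rw [h3, e] at h10 h2
        simp only [mul_zero, zero_add] at h10 h2
        omega
      · omega
    refine Or.inr ⟨by rw [eta, h0]; rfl, i₀ - 1, by omega, fun i hi1 => ?_, ?_⟩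
    · have := congrFun heq i
      simp only [if_neg (show i ≠ 0 by omega), if_neg (show i ≠ 1 by omega)] at this
      rw [eta, eta, this, show i₀ + i - 1 = i + (i₀ - 1) by omega]
    · rw [eta, eta, show i₀ - 1 + 1 = i₀ by omega]
      omega

/-- A word with essentially periodic exponents is purely periodic. -/
lemma HasExponents.exists_period {w : ℕ → Letter} {a : ℕ → ℕ} (ha : HasExponents w a)
    (h : eta a ∈ ESPPlus) : ∃ N, 1 ≤ N ∧ ∀ n, w (n + N) = w n := by
  rcases h.1.2 with ⟨s, hs, hper, hle⟩ | ⟨h0, s, hs, hper, hle⟩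
  · have hper : ∀ i, 1 ≤ i → a (i + s) = a i := fun i hi => Int.natCast_inj.1 (hper i hi)
    have hle : a 0 ≤ a s := Int.ofNat_le.1 hle
    -- Doubling makes the period of the exponents even, so that blocks one period apart carry the
    -- same letter.
    have hper2 : ∀ i, 1 ≤ i → a (i + 2 * s) = a i := fun i hi => by
      rw [two_mul, ← add_assoc, hper _ (by omega), hper _ hi]
    have hle2 : a 0 ≤ a (2 * s) := by rw [two_mul, hper s hs]; exact hle
    have hev : Even (2 * s) := even_two_mul s
    have hs2 : 1 ≤ 2 * s := by omega
    generalize 2 * s = s at *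
    -- The position in block `s` after which exactly `a 0` letters of it remain; from there the word
    -- starts afresh.
    set N := blockStart a (s + 1) - a 0 with hN
    have hSs := blockStart_succ a s
    have hS : ∀ i, blockStart a (i + 1 + s) = blockStart a (i + 1) + N := by
      intro i
      induction i with
      | zero =>
        rw [zero_add, add_comm 1 s, blockStart_succ a 0, blockStart_zero]
        omega
      | succ i ih =>
        rw [blockStart_succ a (i + 1), show i + 1 + 1 + s = i + 1 + s + 1 by omega,
          blockStart_succ, ih, hper2 _ (by omega)]
        omega
    have hpos : 1 ≤ N := by
      have h1 : ∀ i, a 0 + i ≤ blockStart a (i + 1) := by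
        intro i
        induction i with
        | zero => simp [blockStart_succ, blockStart_zero]
        | succ i ih =>
          have := ha.1 (i + 1) (by omega)
          rw [blockStart_succ]; omega
      have := h1 s
      omega
    refine ⟨N, hpos, fun n => ?_⟩
    obtain ⟨i, h1, h2⟩ := exists_block ha.1 n
    rw [ha.2 i n h1 h2]
    show _ = blockLetter i
    have h3 := hS i
    cases i with
    | zero =>
      rw [zero_add, blockStart_succ, blockStart_zero] at h2
      rw [ha.2 s (n + N) (show blockStart a s ≤ _ by omega)
        (show _ < blockStart a (s + 1) by omega)]
      show blockLetter s = _
      rw [← blockLetter_add_of_even hev 0, zero_add]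
    | succ i =>
      have h4 := hS i
      rw [ha.2 (i + 1 + s) (n + N) (show blockStart a _ ≤ _ by omega)
        (show _ < blockStart a (i + 1 + s + 1) by
          rw [show i + 1 + s + 1 = i + 1 + 1 + s by omega]; omega)]
      exact blockLetter_add_of_even hev _
  · have h0 : a 0 = 0 := Int.natCast_inj.1 h0
    have hper : ∀ i, 2 ≤ i → a (i + s) = a i := fun i hi => Int.natCast_inj.1 (hper i hi)
    have hle : a 1 ≤ a (s + 1) := Int.ofNat_le.1 hle
    have hper2 : ∀ i, 2 ≤ i → a (i + 2 * s) = a i := fun i hi => by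
      rw [two_mul, ← add_assoc, hper _ (by omega), hper _ hi]
    have hle2 : a 1 ≤ a (2 * s + 1) := by
      rw [show 2 * s + 1 = s + 1 + s by omega, hper _ (by omega)]; exact hle
    have hev : Even (2 * s) := even_two_mul s
    have hs2 : 1 ≤ 2 * s := by omega
    generalize 2 * s = s at *
    -- Block 0 is empty, so the restart is where `a 1` letters of block `s + 1` remain.
    set N := blockStart a (s + 2) - a 1 with hN
    have hSs : blockStart a (s + 2) = blockStart a (s + 1) + a (s + 1) := blockStart_succ a (s + 1)
    have hS2 : blockStart a 2 = a 1 := by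
      rw [blockStart_succ, blockStart_succ, blockStart_zero, h0]; omega
    have hS : ∀ i, blockStart a (i + 2 + s) = blockStart a (i + 2) + N := by
      intro i
      induction i with
      | zero => rw [zero_add, hS2, add_comm 2 s]; omega
      | succ i ih =>
        rw [show i + 1 + 2 = i + 2 + 1 by omega, blockStart_succ a (i + 2),
          show i + 2 + 1 + s = i + 2 + s + 1 by omega, blockStart_succ, ih, hper2 _ (by omega)]
        omega
    have hpos : 1 ≤ N := by
      have h1 : ∀ i, a 1 + i ≤ blockStart a (i + 2) := by
        intro i
        induction i with
        | zero => rw [zero_add, hS2]; simp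
        | succ i ih =>
          have := ha.1 (i + 2) (by omega)
          rw [show i + 1 + 2 = i + 2 + 1 by omega, blockStart_succ]; omega
      have := h1 s
      omega
    refine ⟨N, hpos, fun n => ?_⟩
    obtain ⟨i, h1, h2⟩ := exists_block ha.1 n
    rw [ha.2 i n h1 h2]
    show _ = blockLetter i
    match i, h1, h2 with
    | 0, h1, h2 =>
      rw [zero_add, blockStart_succ, blockStart_zero] at h2
      omega
    | 1, h1, h2 =>
      rw [one_add_one_eq_two, hS2] at h2
      rw [ha.2 (s + 1) (n + N) (show blockStart a (s + 1) ≤ _ by omega)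
        (show _ < blockStart a (s + 2) by omega)]
      show blockLetter (s + 1) = _
      rw [add_comm, blockLetter_add_of_even hev]
    | i + 2, h1, h2 =>
      have h4 := hS i
      have h3 := hS (i + 1)
      rw [show i + 1 + 2 = i + 2 + 1 by omega] at h3
      rw [ha.2 (i + 2 + s) (n + N) (show blockStart a _ ≤ _ by omega)
        (show _ < blockStart a (i + 2 + s + 1) by
          rw [show i + 2 + s + 1 = i + 2 + 1 + s by omega]; omega)]
      exact blockLetter_add_of_even hev _

lemma HasExponents.exists_L_and_R {w : ℕ → Letter} {a : ℕ → ℕ} (ha : HasExponents w a) :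
    (∃ n, w n = Letter.L) ∧ ∃ n, w n = Letter.R := by
  have h : ∀ i, 1 ≤ i → w (blockStart a i) = blockLetter i := fun i hi =>
    ha.2 i _ le_rfl (by
      have := ha.1 i hi
      show _ < blockStart a (i + 1)
      rw [blockStart_succ]; omega)
  exact ⟨⟨_, h 2 (by omega)⟩, ⟨_, h 1 le_rfl⟩⟩

lemma exists_hasExponents_of_periodic {w : ℕ → Letter} {N : ℕ} (hN : 1 ≤ N)
    (hw : ∀ n, w (n + N) = w n) (hL : ∃ n, w n = Letter.L) (hR : ∃ n, w n = Letter.R) :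
    ∃ a, HasExponents w a ∧ eta a ∈ ESPPlus := by
  obtain ⟨a, ha⟩ := exists_hasExponents (w := w) (by
    intro l m
    obtain ⟨n, hn⟩ : ∃ n, w n = l := by cases l <;> assumption
    exact ⟨n + m * N, le_add_left (Nat.le_mul_of_pos_right m hN),
      (add_mul_of_periodic hw n m).trans hn⟩)
  exact ⟨a, ha, ha.eta_mem_ESPPlus hN hw⟩

/-! ### Homotopies of paths with the same terminal point -/

/-- With `A` at `∞` the edge is a vertical line and `α` is a real number. The straight-line homotopy
then stays in `ℍ`, starts on the line, and is no farther from `α` than the sum of the distances of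
the two paths. -/
lemma homotopicRelEdge {A B α : Bdry} {ζ ξ : C(ℝ≥0, ℍ)} (hζ : ζ 0 ∈ geodesic A B)
    (hξ : ξ 0 ∈ geodesic A B) (hζα : TerminatesAt ζ α) (hξα : TerminatesAt ξ α) (hα : α ≠ A) :
    HomotopicRelEdge A B α ζ ξ := by
  obtain ⟨g, b, hB, hA⟩ := exists_bdryAct_coe_infty (ne_of_mem_geodesic hζ).symm
  obtain ⟨x, hx⟩ : ∃ x : ℝ, bdryAct g α = (x : Bdry) := by
    rcases infty_or_coe (bdryAct g α) with h | h
    · exact absurd (bdryAct_injective g (h.trans hA.symm)) hα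
    · exact h
  have hζ' := tendsto_toSphere_smul g hζα
  have hξ' := tendsto_toSphere_smul g hξα
  rw [hx, tendsto_toSphere_coe_iff] at hζ' hξ'
  rw [← smul_mem_geodesic g, hA, hB, mem_geodesic_infty_coe] at hζ hξ
  let F : I × ℝ≥0 → ℍ := fun p =>
    ⟨(1 - (p.1 : ℝ) : ℝ) * (g • ζ p.2 : ℍ) + ((p.1 : ℝ) : ℂ) * (g • ξ p.2 : ℍ), by
      have h1 := (g • ζ p.2).im_pos
      have h2 := (g • ξ p.2).im_pos
      have h3 := p.1.2.1
      have h4 := p.1.2.2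
      rw [Complex.add_im, Complex.im_ofReal_mul, Complex.im_ofReal_mul, UpperHalfPlane.coe_im,
        UpperHalfPlane.coe_im]
      rcases h3.eq_or_lt with h | h
      · rw [← h]; simpa using h1
      · have := mul_pos h h2
        have := mul_nonneg (sub_nonneg.2 h4) h1.le
        linarith⟩
  have hFc : ∀ p, ((F p : ℍ) : ℂ) =
    (1 - (p.1 : ℝ) : ℝ) * (g • ζ p.2 : ℍ) + ((p.1 : ℝ) : ℂ) * (g • ξ p.2 : ℍ) := fun p => rfl
  have hF : Continuous F := by
    rw [UpperHalfPlane.isEmbedding_coe.continuous_iff]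
    have c1 : Continuous fun p : I × ℝ≥0 => ((g • ζ p.2 : ℍ) : ℂ) :=
      UpperHalfPlane.continuous_coe.comp ((ζ.continuous.comp continuous_snd).const_smul g)
    have c2 : Continuous fun p : I × ℝ≥0 => ((g • ξ p.2 : ℍ) : ℂ) :=
      UpperHalfPlane.continuous_coe.comp ((ξ.continuous.comp continuous_snd).const_smul g)
    have c3 : Continuous fun p : I × ℝ≥0 => (p.1 : ℝ) :=
      continuous_subtype_val.comp continuous_fst
    exact ((Complex.continuous_ofReal.comp (continuous_const.sub c3)).mul c1).add
      ((Complex.continuous_ofReal.comp c3).mul c2)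
  have hFx : Tendsto (fun p => toSphere (F p)) ((⊤ : Filter I) ×ˢ (atTop : Filter ℝ≥0))
      (𝓝 (bdryToSphere (x : Bdry))) := by
    rw [tendsto_toSphere_coe_iff, tendsto_iff_norm_sub_tendsto_zero]
    rw [tendsto_iff_norm_sub_tendsto_zero] at hζ' hξ'
    have h1 := (hζ'.add hξ').comp (tendsto_snd (f := (⊤ : Filter I)) (g := (atTop : Filter ℝ≥0)))
    rw [add_zero] at h1
    refine squeeze_zero (fun _ => norm_nonneg _) (fun p => ?_) h1
    have e : ((F p : ℍ) : ℂ) - x = (1 - (p.1 : ℝ) : ℝ) * ((g • ζ p.2 : ℍ) - (x : ℂ)) +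
        ((p.1 : ℝ) : ℂ) * ((g • ξ p.2 : ℍ) - (x : ℂ)) := by
      rw [hFc]; push_cast; ring
    rw [e]
    have h3 := p.1.2.1
    have h4 := p.1.2.2
    refine (norm_add_le _ _).trans (add_le_add ?_ ?_) <;>
      rw [norm_mul, Complex.norm_real, Real.norm_eq_abs, abs_of_nonneg (by linarith)]
    · exact mul_le_of_le_one_left (norm_nonneg _) (by linarith)
    · exact mul_le_of_le_one_left (norm_nonneg _) h4
  refine ⟨⟨fun p => g⁻¹ • F p, hF.const_smul _⟩, fun t => ?_, fun t => ?_, fun s => ?_, ?_⟩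
  · have : F (0, t) = g • ζ t := by
      apply UpperHalfPlane.ext
      rw [hFc]; simp
    simp [this]
  · have : F (1, t) = g • ξ t := by
      apply UpperHalfPlane.ext
      rw [hFc]; simp
    simp [this]
  · rw [← smul_mem_geodesic g, hA, hB, mem_geodesic_infty_coe]
    simp only [ContinuousMap.coe_mk, smul_inv_smul]
    have : (F (s, 0)).re = (1 - (s : ℝ)) * (g • ζ 0).re + (s : ℝ) * (g • ξ 0).re := by
      show ((F (s, 0) : ℍ) : ℂ).re = _
      rw [hFc, Complex.add_re, Complex.re_ofReal_mul, Complex.re_ofReal_mul]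
      rfl
    rw [this, hζ, hξ]
    ring
  · have := tendsto_toSphere_smul g⁻¹ hFx
    rwa [← hx, bdryAct_inv_bdryAct] at this

/-! ### Hyperbolic elements -/

lemma exists_conj_diagonal {g : SL(2, ℝ)} (hc : g 1 0 ≠ 0) (htr : 4 < (g 0 0 + g 1 1) ^ 2) :
    ∃ k : SL(2, ℝ), (k * g * k⁻¹) 0 1 = 0 ∧ (k * g * k⁻¹) 1 0 = 0 ∧ 1 < (k * g * k⁻¹) 0 0 ^ 2 := by
  have hd := det_eq_one g
  set a := g 0 0
  set b := g 0 1
  set c := g 1 0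
  set d := g 1 1
  -- The eigenvalue of larger absolute value; the sign of the root follows that of the trace.
  obtain ⟨l, hl1, hl2⟩ : ∃ l : ℝ, l ^ 2 - (a + d) * l + 1 = 0 ∧ 1 < l ^ 2 := by
    set s := √((a + d) ^ 2 - 4)
    have hs : s ^ 2 = (a + d) ^ 2 - 4 := Real.sq_sqrt (by linarith)
    have hs0 : 0 ≤ s := Real.sqrt_nonneg _
    rcases le_total 0 (a + d) with h | h
    · refine ⟨(a + d + s) / 2, by linear_combination hs / 4, ?_⟩
      nlinarith
    · refine ⟨(a + d - s) / 2, by linear_combination hs / 4, ?_⟩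
      nlinarith
  have hne : 2 * l - (a + d) ≠ 0 := by
    intro h
    nlinarith
  -- The fixed points of `g`: `x₁` belongs to the eigenvalue `l` and goes to `∞` under `k`, while
  -- `x₂` goes to `0`. The factor `m` gives `k` determinant 1.
  let x₁ := (l - d) / c
  let x₂ := (a - l) / c
  let m := c / (a + d - 2 * l)
  have hm : m * (x₂ - x₁) = 1 := by
    have : a + d - 2 * l ≠ 0 := fun h => hne (by linarith)
    simp only [m, x₁, x₂]
    field_simp
    ring
  let k : SL(2, ℝ) := ⟨!![1, -x₂; m, -(m * x₁)], by rw [Matrix.det_fin_two_of]; linarith⟩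
  have hx₁ : c * x₁ = l - d := by simp only [x₁]; field_simp
  have hx₂ : c * x₂ = a - l := by simp only [x₂]; field_simp
  have e₁ : a * x₁ + b = x₁ * l := by
    apply mul_left_cancel₀ hc
    linear_combination (a - l) * hx₁ - hd - hl1
  have e₂ : a * x₂ + b - x₂ * (a + d - l) = 0 := by
    apply mul_left_cancel₀ hc
    linear_combination (l - d) * hx₂ - hd - hl1
  let D : SL(2, ℝ) := ⟨!![l, 0; 0, a + d - l], by rw [Matrix.det_fin_two_of]; linarith⟩
  have hg : ∀ i j, g i j = !![a, b; c, d] i j := fun i j =>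
    congrFun (congrFun (Matrix.eta_fin_two (g : Matrix (Fin 2) (Fin 2) ℝ)) i) j
  have hkg : k * g = D * k := by
    ext i j
    rw [Matrix.SpecialLinearGroup.coe_mul, Matrix.SpecialLinearGroup.coe_mul, Matrix.mul_apply,
      Matrix.mul_apply, Fin.sum_univ_two, Fin.sum_univ_two, hg, hg]
    fin_cases i <;> fin_cases j <;> simp [k, D]
    · linear_combination -hx₂
    · linear_combination e₂
    · linear_combination -m * hx₁
    · linear_combination m * e₁
  refine ⟨k, ?_⟩
  rw [hkg, mul_inv_cancel_right]
  exact ⟨rfl, rfl, hl2⟩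

/-- An element that maps an arc strictly into itself is diagonalisable, with eigenvalues that are
not of absolute value `1`, and its fixed points separate the endpoints of the arc. -/
lemma exists_conj_diagonal_of_nested {g : SL(2, ℝ)} {P Q : Bdry}
    (hN : Nested P Q (bdryAct g P) (bdryAct g Q)) (hP : bdryAct g P ≠ P) (hQ : bdryAct g Q ≠ Q) :
    ∃ k : SL(2, ℝ), ∃ p q : ℝ, (k * g * k⁻¹) 0 1 = 0 ∧ (k * g * k⁻¹) 1 0 = 0 ∧
      1 < (k * g * k⁻¹) 0 0 ^ 2 ∧ bdryAct k P = (p : Bdry) ∧ bdryAct k Q = (q : Bdry) ∧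
      q < 0 ∧ 0 < p := by
  have hconj : ∀ (k : SL(2, ℝ)) (Y : Bdry),
      bdryAct k (bdryAct g Y) = bdryAct (k * g * k⁻¹) (bdryAct k Y) := by
    intro k Y
    rw [bdryAct_mul, bdryAct_mul, bdryAct_inv_bdryAct]
  obtain ⟨h, hP0, hQi⟩ := exists_bdryAct_eq_zero_infty hN.1
  obtain ⟨k, hk1, hk2, hk3⟩ : ∃ k : SL(2, ℝ), (k * (h * g * h⁻¹) * k⁻¹) 0 1 = 0 ∧
      (k * (h * g * h⁻¹) * k⁻¹) 1 0 = 0 ∧ 1 < (k * (h * g * h⁻¹) * k⁻¹) 0 0 ^ 2 := by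
    have h1 := (nested_bdryAct h).2 hN
    rw [hconj, hconj, hP0, hQi, nested_coe_infty_iff] at h1
    rw [Ne, ← bdryAct_inj h, hconj, hP0] at hP
    rw [Ne, ← bdryAct_inj h, hconj, hQi] at hQ
    set g' := h * g * h⁻¹
    obtain ⟨p', hp', hpos, hq⟩ := h1
    obtain ⟨q', hq', hpq⟩ := hq.resolve_left hQ
    have hd := det_eq_one g'
    have hc : g' 1 0 ≠ 0 := by
      intro hc
      rw [bdryAct_infty, if_pos hc] at hq'
      exact OnePoint.infty_ne_coe _ hq'
    rw [bdryAct_infty, if_neg hc, OnePoint.coe_eq_coe] at hq'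
    have hd0 : g' 1 1 ≠ 0 := by
      intro hd0
      rw [bdryAct_coe, if_pos (by simp [hd0])] at hp'
      exact OnePoint.infty_ne_coe _ hp'
    have hp0 : p' ≠ 0 := fun h0 => hP (by rw [hp', h0])
    rw [bdryAct_coe, if_neg (by simpa using hd0), OnePoint.coe_eq_coe] at hp'
    simp only [mul_zero, zero_add] at hp'
    have hpos' : 0 < p' := lt_of_le_of_ne hpos (Ne.symm hp0)
    have hb : g' 0 1 = p' * g' 1 1 := by rw [← hp']; field_simp
    have ha : g' 0 0 = q' * g' 1 0 := by rw [← hq']; field_simp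
    -- Writing `a, b, c, d` for the entries, `0 < p' < q'` gives `cd > 0` and then `bc > 0`. So `ad
    -- > 1`, and the squared trace exceeds 4.
    have hcd : (q' - p') * (g' 1 0 * g' 1 1) = 1 := by
      rw [hb, ha] at hd; linarith
    have hcd0 : 0 < g' 1 0 * g' 1 1 := by
      by_contra hneg
      nlinarith
    refine exists_conj_diagonal hc ?_
    have : 1 < g' 0 0 * g' 1 1 := by
      have : 0 < g' 0 1 * g' 1 0 := by
        rw [hb]
        have := mul_pos hpos' hcd0
        linarith
      linarith
    nlinarith [sq_nonneg (g' 0 0 - g' 1 1)]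
  have e : k * (h * g * h⁻¹) * k⁻¹ = (k * h) * g * (k * h)⁻¹ := by group
  rw [e] at hk1 hk2 hk3
  generalize k * h = k at *
  have h1 := (nested_bdryAct k).2 hN
  rw [hconj, hconj] at h1
  rw [Ne, ← bdryAct_inj k, hconj] at hP hQ
  set g' := k * g * k⁻¹
  have hinf : bdryAct g' ∞ = ∞ := by rw [bdryAct_infty, if_pos hk2]
  obtain ⟨p, hp⟩ : ∃ p : ℝ, bdryAct k P = (p : Bdry) := by
    rcases infty_or_coe (bdryAct k P) with h | h
    · exact absurd (by rw [h, hinf]) hP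
    · exact h
  obtain ⟨q, hq⟩ : ∃ q : ℝ, bdryAct k Q = (q : Bdry) := by
    rcases infty_or_coe (bdryAct k Q) with h | h
    · exact absurd (by rw [h, hinf]) hQ
    · exact h
  refine ⟨k, p, q, hk1, hk2, hk3, hp, hq, ?_⟩
  rw [hp, bdryAct_coe_of_fixes_infty hk2, hk1, mul_zero, add_zero] at h1 hP
  rw [hq, bdryAct_coe_of_fixes_infty hk2, hk1, mul_zero, add_zero] at h1 hQ
  set r := g' 0 0 ^ 2
  -- Multiplication by `r > 1` pushes points away from `0`. It can map the arc into itself with both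
  -- endpoints moved only if `q < 0 < p`.
  have m1 : 0 < p → p < r * p := fun h => by nlinarith
  have m2 : p < 0 → r * p < p := fun h => by nlinarith
  have m3 : 0 < q → q < r * q := fun h => by nlinarith
  have m4 : q < 0 → r * q < q := fun h => by nlinarith
  have m5 : p < q → r * p < r * q := fun h => by nlinarith
  have m6 : q < p → r * q < r * p := fun h => by nlinarith
  have m7 : p ≠ 0 := by rintro rfl; simp at hP
  have m8 : q ≠ 0 := by rintro rfl; simp at hQ
  generalize r * p = x at *
  generalize r * q = y at *
  obtain ⟨n1, n2, n3, n4⟩ := h1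
  have n3 := n3.resolve_left hP
  have n4 := n4.resolve_left hQ
  rw [clockwise_coe_iff, clockwise_coe_iff] at n3 n4
  have m9 : p ≠ q := fun h => n1 (by rw [h])
  grind

lemma smul_axis {g : SL(2, ℝ)} (h01 : g 0 1 = 0) (h10 : g 1 0 = 0) {y : ℝ} (z w : ℍ)
    (hz : (z : ℂ) = ⟨0, y⟩) (hw : (w : ℂ) = ⟨0, g 0 0 ^ 2 * y⟩) : g • z = w := by
  have hd := det_eq_one g
  rw [h01, zero_mul, sub_zero] at hd
  have h1 : g 1 1 ≠ 0 := by rintro h1; simp [h1] at hd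
  have hd' : (g 0 0 : ℂ) * g 1 1 = 1 := by exact_mod_cast hd
  have h1' : (g 1 1 : ℂ) ≠ 0 := by exact_mod_cast h1
  apply UpperHalfPlane.ext
  rw [coe_smul_eq, hw, hz, h01, h10]
  have e1 : (⟨0, y⟩ : ℂ) = y * Complex.I := by apply Complex.ext <;> simp
  have e2 : (⟨0, g 0 0 ^ 2 * y⟩ : ℂ) = (g 0 0 : ℂ) ^ 2 * y * Complex.I := by
    rw [Complex.mk_eq_add_mul_I]; push_cast; ring
  rw [e1, e2]
  simp only [Complex.ofReal_zero, zero_mul, add_zero, zero_add]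
  rw [div_eq_iff h1']
  linear_combination -(g 0 0 : ℂ) * y * Complex.I * hd'

/-- A hyperbolic element of `Γ` that maps an arc strictly into itself is represented by a closed
curve crossing the corresponding geodesic. -/
lemma exists_closedCurve {g : SL(2, ℝ)} (hg : g ∈ Γ) {P Q α : Bdry}
    (hN : Nested P Q (bdryAct g P) (bdryAct g Q)) (hP : bdryAct g P ≠ P) (hQ : bdryAct g Q ≠ Q)
    {ζ : C(ℝ≥0, ℍ)} (hend : TerminatesAt ζ α)
    (hζ : ∀ n : ℕ, ∀ᶠ t in atTop, ζ t ∈ rightOf (bdryAct (g ^ n) P) (bdryAct (g ^ n) Q)) :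
    ∃ c : ClosedCurve Γ, ¬ c.IsPeripheral ∧ c.lift 0 ∈ geodesic P Q ∧
      (∀ᶠ t in atTop, c.lift t ∈ rightOf P Q) ∧ (∀ᶠ t in atBot, c.lift t ∈ rightOf Q P) ∧
      TerminatesAt c.ray α ∧ α ≠ P ∧ α ≠ Q := by
  obtain ⟨k, p, q, hk1, hk2, hk3, hp, hq, hq0, hp0⟩ := exists_conj_diagonal_of_nested hN hP hQ
  have hconj : ∀ (Y : Bdry), bdryAct k (bdryAct g Y) = bdryAct (k * g * k⁻¹) (bdryAct k Y) := by
    intro Y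
    rw [bdryAct_mul, bdryAct_mul, bdryAct_inv_bdryAct]
  set g' := k * g * k⁻¹ with hg'
  set r := g' 0 0 ^ 2 with hr
  have hr0 : 0 < r := by linarith
  have hpow : ∀ n : ℕ, bdryAct k (bdryAct (g ^ n) P) = ((r ^ n * p : ℝ) : Bdry) ∧
      bdryAct k (bdryAct (g ^ n) Q) = ((r ^ n * q : ℝ) : Bdry) := by
    intro n
    induction n with
    | zero => simp [bdryAct_one, hp, hq]
    | succ n ih =>
      rw [pow_succ', bdryAct_mul, bdryAct_mul, hconj, hconj, ih.1, ih.2,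
        bdryAct_coe_of_fixes_infty hk2, bdryAct_coe_of_fixes_infty hk2, hk1, ← hr]
      constructor <;> rw [OnePoint.coe_eq_coe] <;> ring
  -- The half planes behind the translated edges are the exteriors of semicircles around `0` scaled
  -- by `r ^ n`, so `k • ζ` is unbounded and cannot end at a finite point.
  have hα : bdryAct k α = ∞ := by
    have hlim := tendsto_toSphere_smul k hend
    rcases infty_or_coe (bdryAct k α) with h | ⟨x, h⟩
    · exact h
    exfalso
    rw [h, tendsto_toSphere_coe_iff] at hlim
    have htop : Tendsto (fun t => ‖((k • ζ t : ℍ) : ℂ)‖) atTop atTop := by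
      rw [tendsto_atTop]
      intro M
      obtain ⟨m, hm0, hmp, hmq⟩ : ∃ m : ℝ, 0 < m ∧ m ≤ p ∧ m ≤ -q :=
        ⟨min p (-q), lt_min hp0 (by linarith), min_le_left _ _, min_le_right _ _⟩
      obtain ⟨n, hn⟩ := ((tendsto_pow_atTop_atTop_of_one_lt hk3).atTop_mul_const
        hm0).eventually_ge_atTop M |>.exists
      filter_upwards [hζ n] with t ht
      refine hn.trans ?_
      rw [← smul_mem_rightOf k, (hpow n).1, (hpow n).2, mem_rightOf_coe] at ht
      have hrn : 0 < r ^ n := pow_pos hr0 n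
      have hm' : 0 < r ^ n * m := mul_pos hrn hm0
      have h1 : r ^ n * m ≤ r ^ n * p := mul_le_mul_of_nonneg_left hmp hrn.le
      have h2 : r ^ n * m ≤ -(r ^ n * q) := by nlinarith
      generalize r ^ n * p = u at *
      generalize r ^ n * q = v at *
      change r ^ n * m ≤ _
      generalize r ^ n * m = s at *
      generalize k • ζ t = z at *
      have hz : ‖(z : ℂ)‖ ^ 2 = z.re ^ 2 + z.im ^ 2 := by
        rw [Complex.sq_norm, Complex.normSq_apply]
        rw [UpperHalfPlane.coe_re, UpperHalfPlane.coe_im]; ring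
      have h3 : 0 < (z.re - u) * (z.re - v) + z.im ^ 2 := by
        by_contra hc
        nlinarith
      by_contra hlt
      push Not at hlt
      have hsq : z.re ^ 2 + z.im ^ 2 < s ^ 2 := by
        rw [← hz]; exact pow_lt_pow_left₀ hlt (norm_nonneg _) two_ne_zero
      have hab : |z.re| < s := abs_lt_of_sq_lt_sq (by nlinarith [sq_nonneg z.im]) hm'.le
      obtain ⟨h4, h5⟩ := abs_lt.1 hab
      nlinarith [mul_nonneg (show 0 ≤ u - s by linarith) (show 0 ≤ -v - s by linarith)]
    exact not_tendsto_atTop_of_tendsto_nhds hlim.norm htop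
  -- The height at which the imaginary axis meets the geodesic from `p` to `q`; the curve `i ρ r ^
  -- t` along the axis therefore starts on the edge, and `g'` advances `t` by 1.
  set ρ := √(-(p * q)) with hρ
  have hpq : 0 < -(p * q) := by nlinarith
  have hρ0 : 0 < ρ := Real.sqrt_pos.2 hpq
  have hρ2 : ρ ^ 2 = -(p * q) := Real.sq_sqrt hpq.le
  have hpos : ∀ t : ℝ, 0 < ρ * r ^ t := fun t => mul_pos hρ0 (Real.rpow_pos_of_pos hr0 t)
  let w : ℝ → ℍ := fun t => ⟨⟨0, ρ * r ^ t⟩, hpos t⟩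
  have hwc : ∀ t, ((w t : ℍ) : ℂ) = ((ρ * r ^ t : ℝ) : ℂ) * Complex.I := by
    intro t
    apply Complex.ext <;> simp [w]
  have hw : Continuous w := by
    rw [UpperHalfPlane.isEmbedding_coe.continuous_iff]
    have : (fun t => ((w t : ℍ) : ℂ)) = fun t => ((ρ * r ^ t : ℝ) : ℂ) * Complex.I := funext hwc
    show Continuous fun t => ((w t : ℍ) : ℂ)
    rw [this]
    exact (Complex.continuous_ofReal.comp
      (continuous_const.mul (Real.continuous_const_rpow hr0.ne'))).mul continuous_const
  have hw1 : ∀ t, w (t + 1) = g' • w t := by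
    intro t
    refine (smul_axis hk1 hk2 (w t) (w (t + 1)) rfl ?_).symm
    show (⟨0, ρ * r ^ (t + 1)⟩ : ℂ) = ⟨0, r * (ρ * r ^ t)⟩
    rw [Real.rpow_add_one hr0.ne']
    congr 1
    ring
  let c : ClosedCurve Γ := ⟨⟨fun t => k⁻¹ • w t, hw.const_smul _⟩, g, hg, fun t => by
    show k⁻¹ • w (t + 1) = g • k⁻¹ • w t
    rw [hw1, hg', ← mul_smul, ← mul_smul]
    congr 1
    group⟩
  have hc : ∀ t, c.lift t = k⁻¹ • w t := fun t => rfl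
  have hre : ∀ t, (w t).re = 0 := fun t => rfl
  have him : ∀ t, (w t).im ^ 2 = -(p * q) * (r ^ t) ^ 2 := fun t => by
    show (ρ * r ^ t) ^ 2 = _
    rw [mul_pow, hρ2]
  refine ⟨c, ?_, ?_, ?_, ?_, ?_, ?_, ?_⟩
  · intro hpar
    have hgg : Matrix.SpecialLinearGroup.toGL g' = Matrix.SpecialLinearGroup.toGL k *
        Matrix.SpecialLinearGroup.toGL g * (Matrix.SpecialLinearGroup.toGL k)⁻¹ := by
      rw [hg', map_mul, map_mul, map_inv]
    have h1 := (Matrix.GeneralLinearGroup.isParabolic_conj_iff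
      (Matrix.SpecialLinearGroup.toGL k) _).2 hpar
    change (Matrix.SpecialLinearGroup.toGL k * Matrix.SpecialLinearGroup.toGL g *
      (Matrix.SpecialLinearGroup.toGL k)⁻¹).IsParabolic at h1
    rw [← hgg] at h1
    have h2 : g' 0 0 = g' 1 1 :=
      ((Matrix.GeneralLinearGroup.isParabolic_iff_of_upperTriangular hk2).1 h1).1
    have hd := det_eq_one g'
    rw [hk1, zero_mul, sub_zero, ← h2] at hd
    nlinarith
  · rw [hc, ← smul_mem_geodesic k, smul_inv_smul, hp, hq, mem_geodesic_coe, hre, him]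
    simp
  · filter_upwards [eventually_gt_atTop 0] with t ht
    rw [hc, ← smul_mem_rightOf k, smul_inv_smul, hp, hq, mem_rightOf_coe, hre, him]
    have h1 : 1 < r ^ t := Real.one_lt_rpow hk3 ht
    have h2 : 1 < (r ^ t) ^ 2 := by nlinarith
    exact mul_neg_of_neg_of_pos (by linarith) (by nlinarith)
  · filter_upwards [eventually_lt_atBot 0] with t ht
    rw [hc, ← smul_mem_rightOf k, smul_inv_smul, hp, hq, mem_rightOf_coe, hre, him]
    have h1 : r ^ t < 1 := Real.rpow_lt_one_of_one_lt_of_neg hk3 ht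
    have h0 : 0 < r ^ t := Real.rpow_pos_of_pos hr0 t
    have h2 : (r ^ t) ^ 2 < 1 := by nlinarith
    exact mul_neg_of_pos_of_neg (by linarith) (by nlinarith)
  · have h1 : Tendsto (fun t : ℝ≥0 => toSphere (w t)) atTop (𝓝 (bdryToSphere ∞)) := by
      rw [tendsto_toSphere_infty_iff]
      have h2 : Tendsto (fun t : ℝ => ρ * r ^ t) atTop atTop :=
        (tendsto_rpow_atTop_of_base_gt_one r hk3).const_mul_atTop hρ0
      refine (h2.comp (NNReal.tendsto_coe_atTop.2 tendsto_id)).congr fun t => ?_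
      rw [hwc, norm_mul, Complex.norm_I, mul_one, Complex.norm_real, Real.norm_eq_abs,
        abs_of_pos (hpos _)]
      rfl
    have h2 := tendsto_toSphere_smul k⁻¹ h1
    rwa [← hα, bdryAct_inv_bdryAct] at h2
  · rintro rfl
    exact OnePoint.coe_ne_infty _ (hp.symm.trans hα)
  · rintro rfl
    exact OnePoint.coe_ne_infty _ (hq.symm.trans hα)

/-! ### Symmetries and closed curves from periodic words -/

/-- The symmetry of a triangulation that shifts a purely periodic cutting word. -/
lemma IsQuotientTriangulation.exists_shift (hT : IsQuotientTriangulation Γ T) {P Q V : ℕ → Bdry}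
    {w : ℕ → Letter} (hV : ∀ n, {P n, Q n, V n} ∈ T ∧ Clockwise (P n) (Q n) (V n))
    (hw : ∀ n, (w n = Letter.L ∧ P (n + 1) = V n ∧ Q (n + 1) = Q n) ∨
      (w n = Letter.R ∧ P (n + 1) = P n ∧ Q (n + 1) = V n))
    {N : ℕ} (hN : 1 ≤ N) (hper : ∀ n, w (n + N) = w n) :
    ∃ g ∈ Γ, ∃ d, 1 ≤ d ∧ (∀ n, w (n + d) = w n) ∧
      ∀ n, P (n + d) = bdryAct g (P n) ∧ Q (n + d) = bdryAct g (Q n) := by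
  obtain ⟨F, hF, hFT⟩ := hT.finiteQuotient
  choose γ hγ hγF using fun n => hFT _ (hV (n * N)).1
  -- Pigeonhole: the edges at the multiples of `N`, moved into the representatives, take finitely
  -- many values. Members of `F` that are infinite sets are discarded, as they represent no
  -- triangle.
  have hfin : (⋃ f ∈ {f ∈ F | f.Finite}, f ×ˢ f).Finite :=
    (hF.subset (Set.sep_subset _ _)).biUnion fun f hf => hf.2.prod hf.2
  obtain ⟨m, n, hmn, heq⟩ := hfin.exists_lt_map_eq_of_forall_mem
    (f := fun n => (bdryAct (γ n) (P (n * N)), bdryAct (γ n) (Q (n * N)))) (fun n => by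
      refine Set.mem_biUnion ⟨hγF n, Set.Finite.image _ (by simp)⟩ ⟨?_, ?_⟩ <;>
        exact Set.mem_image_of_mem _ (by simp))
  obtain ⟨h1, h2⟩ := Prod.mk.inj heq
  set g := (γ n)⁻¹ * γ m
  have hg : g ∈ Γ := mul_mem (inv_mem (hγ n)) (hγ m)
  have third : ∀ {A B C D : Bdry}, Clockwise A B C → {A, B, C} ∈ T →
      Clockwise (bdryAct g A) (bdryAct g B) D → {bdryAct g A, bdryAct g B, D} ∈ T →
      D = bdryAct g C := fun k1 k2 k3 k4 =>
    hT.triangulation.third_unique k3 ((clockwise_bdryAct g).2 k1) k4 (hT.triangle_bdryAct hg k2)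
  set d := (n - m) * N with hd
  have hnm : n * N = m * N + d := by
    rw [hd, ← add_mul]; congr 1; omega
  have hwd : ∀ i, w (i + d) = w i := fun i => add_mul_of_periodic hper i _
  have forward : ∀ i j, P j = bdryAct g (P i) → Q j = bdryAct g (Q i) → w j = w i →
      P (j + 1) = bdryAct g (P (i + 1)) ∧ Q (j + 1) = bdryAct g (Q (i + 1)) := by
    intro i j hP hQ hij
    have hVj := hV j
    rw [hP, hQ] at hVj
    have := third (hV i).2 (hV i).1 hVj.2 hVj.1
    rcases hw i with ⟨l1, l2, l3⟩ | ⟨l1, l2, l3⟩ <;> rcases hw j with ⟨k1, k2, k3⟩ | ⟨k1, k2, k3⟩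
    · rw [k2, k3, l2, l3]; exact ⟨this, hQ⟩
    · rw [hij, l1] at k1; cases k1
    · rw [hij, l1] at k1; cases k1
    · rw [k2, k3, l2, l3]; exact ⟨hP, this⟩
  -- The later oriented edge and the letter determine the earlier edge, whose missing endpoint is
  -- the third vertex of the same triangle. So the symmetry, found at `m * N`, can be carried back
  -- to index 0.
  have backward : ∀ i j, P (j + 1) = bdryAct g (P (i + 1)) → Q (j + 1) = bdryAct g (Q (i + 1)) →
      w j = w i → P j = bdryAct g (P i) ∧ Q j = bdryAct g (Q i) := by
    intro i j hP hQ hij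
    rcases hw i with ⟨l1, l2, l3⟩ | ⟨l1, l2, l3⟩ <;> rcases hw j with ⟨k1, k2, k3⟩ | ⟨k1, k2, k3⟩
    · rw [k2, l2] at hP
      rw [k3, l3] at hQ
      refine ⟨?_, hQ⟩
      have e : ∀ A B C : Bdry, ({B, C, A} : Set Bdry) = {A, B, C} := by
        intro A B C; ext; simp; tauto
      have hVj := hV j
      rw [← e, hP, hQ] at hVj
      have hVi := hV i
      rw [← e] at hVi
      exact third hVi.2.rotate hVi.1 (hP ▸ hQ ▸ (hV j).2.rotate) hVj.1
    · rw [hij, l1] at k1; cases k1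
    · rw [hij, l1] at k1; cases k1
    · rw [k2, l2] at hP
      rw [k3, l3] at hQ
      refine ⟨hP, ?_⟩
      have e : ∀ A B C : Bdry, ({C, A, B} : Set Bdry) = {A, B, C} := by
        intro A B C; ext; simp; tauto
      have hVj := hV j
      rw [← e, hP, hQ] at hVj
      have hVi := hV i
      rw [← e] at hVi
      exact third hVi.2.rotate.rotate hVi.1 (hP ▸ hQ ▸ (hV j).2.rotate.rotate) hVj.1
  have hmid : P (m * N + d) = bdryAct g (P (m * N)) ∧ Q (m * N + d) = bdryAct g (Q (m * N)) := by
    rw [← hnm, bdryAct_mul, bdryAct_mul, h1, h2]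
    simp
  have hzero : ∀ i, P (i + d) = bdryAct g (P i) ∧ Q (i + d) = bdryAct g (Q i) →
      P (0 + d) = bdryAct g (P 0) ∧ Q (0 + d) = bdryAct g (Q 0) := by
    intro i
    induction i with
    | zero => exact id
    | succ i ih =>
      intro h
      rw [show i + 1 + d = i + d + 1 by omega] at h
      exact ih (backward i (i + d) h.1 h.2 (hwd i))
  refine ⟨g, hg, d, Nat.mul_pos (by omega) hN, hwd, fun i => ?_⟩
  induction i with
  | zero => exact hzero _ hmid
  | succ i ih =>
    rw [show i + 1 + d = i + d + 1 by omega]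
    exact forward i (i + d) ih.1 ih.2 (hwd i)

lemma HomotopicRelEdge.swap {A B α : Bdry} {ζ ξ : C(ℝ≥0, ℍ)} (h : HomotopicRelEdge A B α ζ ξ) :
    HomotopicRelEdge B A α ζ ξ := by
  obtain ⟨H, h1, h2, h3, h4⟩ := h
  exact ⟨H, h1, h2, fun s => by rw [geodesic_swap]; exact h3 s, h4⟩

lemma apply_mod_of_periodic {X : Type*} {w : ℕ → X} {N : ℕ} (h : ∀ n, w (n + N) = w n) (n : ℕ) :
    w (n % N) = w n := by
  conv_rhs => rw [← Nat.mod_add_div' n N, add_mul_of_periodic h]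

/-- A path with a purely periodic cutting word containing both letters is homotopic to a closed
curve. -/
lemma homotopicToClosedCurve_of_periodic (hT : IsQuotientTriangulation Γ T) {A B α : Bdry}
    {ζ : C(ℝ≥0, ℍ)} (hstart : ζ 0 ∈ geodesic A B) (hend : TerminatesAt ζ α) {w : ℕ → Letter}
    (hw : IsCuttingWord T A B ζ w) {N : ℕ} (hN : 1 ≤ N) (hper : ∀ n, w (n + N) = w n)
    (hL : ∃ n, w n = Letter.L) (hR : ∃ n, w n = Letter.R) :
    HomotopicToClosedCurve Γ A B α ζ := by
  obtain ⟨P, Q, V, h0, hζ, hV, hPQ⟩ := hw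
  obtain ⟨g, hg, d, hd, hwd, hshift⟩ := hT.exists_shift hV hPQ hN hper
  have hstep : ∀ n, Step T ((fun n => (P n, Q n)) n) ((fun n => (P n, Q n)) (n + 1)) := by
    intro n
    refine ⟨V n, (hV n).1, (hV n).2, ?_⟩
    rcases hPQ n with ⟨-, h1, h2⟩ | ⟨-, h1, h2⟩
    · exact Or.inl (Prod.ext h1 h2)
    · exact Or.inr (Prod.ext h1 h2)
  have hnest : ∀ {m n : ℕ}, m ≤ n → Nested (P m) (Q m) (P n) (Q n) := fun h =>
    nested_of_steps hstep h
  obtain ⟨hPd, hQd⟩ := hshift 0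
  rw [zero_add] at hPd hQd
  -- An `L` within the first `d` letters moves the left endpoint, and nesting forbids its return;
  -- `R` does the same for the right endpoint.
  have hP : bdryAct g (P 0) ≠ P 0 := by
    rw [← hPd]
    intro h
    obtain ⟨n, hn⟩ := hL
    rw [← apply_mod_of_periodic hwd] at hn
    have hlt := Nat.mod_lt n hd
    have e1 := (hnest (Nat.zero_le (n % d))).left_eq (hnest hlt.le) h
    have e2 := (hnest (Nat.zero_le (n % d + 1))).left_eq (hnest hlt) h
    rcases hPQ (n % d) with ⟨-, h1, -⟩ | ⟨h1, -⟩
    · exact (hV (n % d)).2.rotate.rotate.ne (by rw [← h1, e1, e2])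
    · rw [hn] at h1; cases h1
  have hQ : bdryAct g (Q 0) ≠ Q 0 := by
    rw [← hQd]
    intro h
    obtain ⟨n, hn⟩ := hR
    rw [← apply_mod_of_periodic hwd] at hn
    have hlt := Nat.mod_lt n hd
    have e1 := (hnest (Nat.zero_le (n % d))).right_eq (hnest hlt.le) h
    have e2 := (hnest (Nat.zero_le (n % d + 1))).right_eq (hnest hlt) h
    rcases hPQ (n % d) with ⟨h1, -⟩ | ⟨-, -, h1⟩
    · rw [hn] at h1; cases h1
    · exact (hV (n % d)).2.rotate.ne (by rw [← h1, e1, e2])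
  have hN' := hnest (Nat.zero_le d)
  rw [hPd, hQd] at hN'
  have hmul : ∀ n : ℕ, P (n * d) = bdryAct (g ^ n) (P 0) ∧ Q (n * d) = bdryAct (g ^ n) (Q 0) := by
    intro n
    induction n with
    | zero => simp [bdryAct_one]
    | succ n ih =>
      rw [add_mul, one_mul, (hshift _).1, (hshift _).2, ih.1, ih.2, pow_succ', bdryAct_mul,
        bdryAct_mul]
      exact ⟨rfl, rfl⟩
  obtain ⟨c, hc, hc0, htop, hbot, hcend, hα, hα'⟩ := exists_closedCurve hg hN' hP hQ hend
    (fun n => by rw [← (hmul n).1, ← (hmul n).2]; exact hζ _)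
  have hray0 : c.ray 0 = c.lift 0 := rfl
  rcases h0 with ⟨rfl, rfl⟩ | ⟨rfl, rfl⟩
  · exact ⟨c, hc, ⟨hc0, Or.inl ⟨htop, hbot⟩⟩, homotopicRelEdge hstart hc0 hend hcend hα⟩
  · rw [geodesic_swap] at hc0
    exact ⟨c, hc, ⟨hc0, Or.inr ⟨htop, hbot⟩⟩, homotopicRelEdge hstart hc0 hend hcend hα'⟩

/-- A path that is homotopic to a closed curve has a purely periodic cutting word containing both
letters. -/
lemma HomotopicToClosedCurve.exists_periodic (hT : IsQuotientTriangulation Γ T) {A B α : Bdry}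
    (hE : IsEdge T A B) {ζ : C(ℝ≥0, ℍ)} (hend : TerminatesAt ζ α)
    (h : HomotopicToClosedCurve Γ A B α ζ) :
    ∃ w, IsCuttingWord T A B ζ w ∧ (∃ N, 1 ≤ N ∧ ∀ n, w (n + N) = w n) ∧ (∃ n, w n = Letter.L) ∧
      ∃ n, w n = Letter.R := by
  obtain ⟨c, hc, ⟨hc0, hcross⟩, H, -, hH1, -, hH⟩ := h
  -- The homotopy enters only through its final path: the closed curve runs to `α` as well.
  have hray : Tendsto (fun t : ℝ≥0 => toSphere (c.lift t)) atTop (𝓝 (bdryToSphere α)) := by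
    have h1 : Tendsto (fun t : ℝ≥0 => ((1 : I), t)) atTop ((⊤ : Filter I) ×ˢ atTop) :=
      tendsto_top.prodMk tendsto_id
    refine (hH.comp h1).congr fun t => ?_
    show toSphere (H (1, t)) = _
    rw [hH1]
    rfl
  have hlim : Tendsto (fun t => toSphere (c.lift t)) atTop (𝓝 (bdryToSphere α)) := by
    refine (hray.comp tendsto_real_toNNReal_atTop).congr' ?_
    filter_upwards [eventually_ge_atTop 0] with t ht
    simp [Real.coe_toNNReal t ht]
  rcases hcross with ⟨htop, hbot⟩ | ⟨htop, hbot⟩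
  · exact exists_periodic_cuttingWord hT c hc (Or.inl ⟨rfl, rfl⟩) hE hc0 htop hbot hlim hend
  · rw [geodesic_swap] at hc0
    exact exists_periodic_cuttingWord hT c hc (Or.inr ⟨rfl, rfl⟩) hE.symm hc0 htop hbot hlim hend

end CuttingSeq

theorem theorem3p4 (Γ : Subgroup SL(2, ℝ)) (T : Set (Set Bdry))
    (hT : IsQuotientTriangulation Γ T)
    (A B : Bdry) (hE : IsEdge T A B)
    (ζ : C(ℝ≥0, ℍ)) (hstart : ζ 0 ∈ geodesic A B)
    (α : Bdry) (hend : TerminatesAt ζ α) :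
    HomotopicToClosedCurve Γ A B α ζ ↔
      ∃ a : ℕ → ℕ, IsCuttingSequence T A B ζ a ∧ eta a ∈ ESPPlus := by
  constructor
  · intro h
    obtain ⟨w, hw, ⟨N, hN, hper⟩, hL, hR⟩ := h.exists_periodic hT hE hend
    obtain ⟨a, ha, hESP⟩ := exists_hasExponents_of_periodic hN hper hL hR
    exact ⟨a, ⟨w, hw, ha⟩, hESP⟩
  · rintro ⟨a, ⟨w, hw, ha⟩, hESP⟩
    obtain ⟨N, hN, hper⟩ := ha.exists_period hESP
    obtain ⟨hL, hR⟩ := ha.exists_L_and_R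
    exact homotopicToClosedCurve_of_periodic hT hstart hend hw hN hper hL hR
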